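/- **Setting.** Let $A_1,B_1,A_2,B_2$ be qubits with standard bases $|0\rangle,|1\rangle$. The two samples are $A_1B_1$ and $A_2B_2$. On one sample put $$\phi^0=\tfrac1{\sqrt2}(|00\rangle+|11\rangle),\quad \phi^1=\tfrac{\sqrt{-1}}{\sqrt2}(|01\rangle+|10\rangle),\quad \phi^2=\tfrac1{\sqrt2}(-|01\rangle+|10\rangle),\quad \phi^3=\tfrac{\sqrt{-1}}{\sqrt2}(|00\rangle-|11\rangle),$$ and on two samples $e^{ij}=\phi^i\otimes\phi^j$ $(0\le i,j\le 3)$. A test is a two-outcome measurement $(T_0,T_1)$ with $T_1=I-T_0$ and $0\le T_0\le I$, and it is denoted by $T_0$. For a density matrix $\sigma$ of one sample, test $H_0:\sigma=|\phi^0\rangle\langle\phi^0|$ against $H_1:\sigma\ne|\phi^0\rangle\langle\phi^0|$, given the state $\sigma^{\otimes2}$. The test is of level zero if $\operatorname{Tr}\big((|\phi^0\rangle\langle\phi^0|)^{\otimes2}T_1\big)=0$, and its type 2 error at $\sigma\neq|\phi^0\rangle\langle\phi^0|$ is $\beta(T_0,\sigma^{\otimes2})=\operatorname{Tr}(\sigma^{\otimes2}T_0)$.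 A test in a class of tests is UMP (uniformly most powerful) level zero in this class if it is of level zero and its type 2 error at every $\sigma\ne|\phi^0\rangle\langle\phi^0|$ is at most that of every level-zero test in the class. A test $T_0$ is called * *AB-local* if it is realized by LOCC (local operations and classical communication, with finitely many rounds and outcomes) between $A_1A_2$ and $B_1B_2$; * *samplewise-local* if it is realized by LOCC between $A_1B_1$ and $A_2B_2$; * *V-invariant* if $V(g)^\dagger T_0V(g)=T_0$ for all $g\in SU(2)$, where $V(g)=g\otimes\overline g\otimes g\otimes\overline g$ on $A_1\otimes B_1\otimes A_2\otimes B_2$ and $\overline g$ is the entrywise complex conjugate of $g$; * *AB-invariant* if it is invariant under conjugation by $|i\rangle_{A_1}|j\rangle_{B_1}|k\rangle_{A_2}|l\rangle_{B_2}\mapsto(-1)^{i+j+k+l}|1-j\rangle_{A_1}|1-i\rangle_{B_1}|1-l\rangle_{A_2}|1-k\rangle_{B_2}$; * *termwise AB-covariant* if it is a finite sum $T_0=\sum_i p_i\,M_{A_1,i}\otimes M_{B_1,i}\otimes M_{A_2,i}\otimes M_{B_2,i}$ with $p_i\ge0$ and rank-one projections $M_{X,i}$ on $X$ such that $\operatorname{Tr}(M_{A_1,i}M_{B_1,i}^T)=\operatorname{Tr}(M_{A_2,i}M_{B_2,i}^T)=1$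 for all $i$. Let $K_6^+,K_1^+,K_3^-,L_3^+,L_3^-$ denote the orthogonal projections onto, respectively, $\operatorname{span}\{e^{ij}+e^{ji}:1\le i\le j\le3\}$, $\operatorname{span}\{e^{11}+e^{22}+e^{33}\}$, $\operatorname{span}\{e^{ij}-e^{ji}:1\le i<j\le3\}$, $\operatorname{span}\{e^{0i}+e^{i0}:1\le i\le3\}$, $\operatorname{span}\{e^{0i}-e^{i0}:1\le i\le3\}$, and let $K_5^+=K_6^+-K_1^+$. **Theorem.** The test $$T_0^V=\tfrac1{10}K_5^++\tfrac13L_3^++(|\phi^0\rangle\langle\phi^0|)^{\otimes2}+\tfrac16K_3^-+\tfrac13L_3^-$$ is UMP level zero among the tests that are AB-local, samplewise-local, V-invariant, AB-invariant and termwise AB-covariant. It is also UMP level zero in the class obtained if AB-locality and samplewise-locality are replaced by the requirement that both hold in one and the same protocol, i.e. that the test is realized by LOCC between $A_1,B_1,A_2,B_2$. Moreover $T_0^V$ is invariant under the exchange of the two samples, and its type 2 error at every density matrix $\sigma\ne|\phi^0\rangle\langle\phi^0|$ is $$\beta(T_0^V,\sigma^{\otimes2})=v^TZv-\tfrac2{15}\big((\operatorname{Re}x_{12})^2+(\operatorname{Re}x_{23})^2+(\operatorname{Re}x_{31})^2\big),$$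 where $x_{ij}=\langle\phi^i|\sigma|\phi^j\rangle$ and $$v=\begin{pmatrix}x_{11}-1/2\\x_{22}-1/2\\x_{33}-1/2\end{pmatrix},\qquad Z=\frac1{15}\begin{pmatrix}6&7&7\\7&6&7\\7&7&6\end{pmatrix}.$$ -/

import Mathlib

open Matrix
open scoped Kronecker ComplexOrder

noncomputable section

namespace EntTest

/-! ## Hypothesis testing with two-outcome measurements

A test `(T₀, T₁)` is represented by its element `T₀` (outcome "the null hypothesis is
kept"), with `T₁ = 1 - T₀`. -/

section Testing

variable {n : Type} [Fintype n] [DecidableEq n]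

/-- `T` is the element `T₀` of a two-outcome measurement `(T₀, 1 - T₀)`. -/
def IsTest (T : Matrix n n ℂ) : Prop :=
  T.PosSemidef ∧ (1 - T).PosSemidef

/-- Density matrices. -/
def IsDensity (ρ : Matrix n n ℂ) : Prop :=
  ρ.PosSemidef ∧ ρ.trace = 1

/-- Type 1 error probability `Tr (ρ T₁)`. -/
def typeOneError (T ρ : Matrix n n ℂ) : ℝ :=
  (ρ * (1 - T)).trace.re

/-- Type 2 error probability `Tr (ρ T₀)`. -/
def typeTwoError (T ρ : Matrix n n ℂ) : ℝ :=
  (ρ * T).trace.re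

/-- `T` has level `α` for the null hypothesis `S₀`. -/
def IsLevel (S₀ : Set (Matrix n n ℂ)) (α : ℝ) (T : Matrix n n ℂ) : Prop :=
  ∀ ρ ∈ S₀, typeOneError T ρ ≤ α

/-- `T` is a uniformly most powerful level-`α` test of `S₀` versus `S₁` among the tests
that satisfy the requirement `C`. -/
def IsUMP (C : Matrix n n ℂ → Prop) (S₀ S₁ : Set (Matrix n n ℂ)) (α : ℝ)
    (T : Matrix n n ℂ) : Prop :=
  (IsTest T ∧ C T ∧ IsLevel S₀ α T) ∧
    ∀ ρ ∈ S₁, ∀ T' : Matrix n n ℂ, IsTest T' → C T' → IsLevel S₀ α T' →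
      typeTwoError T ρ ≤ typeTwoError T' ρ

/-- Elements `T₀` of the two-outcome measurements realized by local operations and classical
communication. The set `loc p` consists of the operators that act on the system of party `p`
only. A protocol either announces the outcome `0` (then `T₀ = 1`) or the outcome `1` (then
`T₀ = 0`), or some party performs a measurement on its own system with Kraus operators
`E x`, broadcasts the result `x`, and all parties go on with a protocol that may depend on `x`.
Random choices are the measurements whose Kraus operators are multiples of `1`. By the polar
decomposition of the Kraus operators, local ancillas would not give further tests. -/
inductive IsLOCC {P : Type} (loc : P → Set (Matrix n n ℂ)) : Matrix n n ℂ → Prop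
  | outcomeZero : IsLOCC loc 1
  | outcomeOne : IsLOCC loc 0
  | measure (p : P) (m : ℕ) (E : Fin m → Matrix n n ℂ) (hloc : ∀ x, E x ∈ loc p)
      (hsum : ∑ x, (E x)ᴴ * E x = 1) (T : Fin m → Matrix n n ℂ)
      (hT : ∀ x, IsLOCC loc (T x)) : IsLOCC loc (∑ x, (E x)ᴴ * T x * E x)

/-- The operator `|v⟩⟨v|`. -/
def ketbra (v : n → ℂ) : Matrix n n ℂ :=
  vecMulVec v (star v)

/-- Rank-one orthogonal projections. -/
def IsRankOneProj (M : Matrix n n ℂ) : Prop :=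
  M.IsHermitian ∧ M * M = M ∧ M.rank = 1

end Testing

/-! ## Two samples of a pair of qubits -/

/-- Basis labels `(a, b)` of one sample `A ⊗ B`. -/
abbrev Sample : Type := Fin 2 × Fin 2

/-- Basis labels `((a₁, b₁), (a₂, b₂))` of the two samples `(A₁ ⊗ B₁) ⊗ (A₂ ⊗ B₂)`. -/
abbrev Pair : Type := Sample × Sample

/-- The vectors `φ⁰, φ¹, φ², φ³` of one sample (the entry `(a, b)` of the matrix is the
coefficient of `|a⟩ ⊗ |b⟩`). -/
def phi (i : Fin 4) : Sample → ℂ := fun ab =>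
  ((Real.sqrt 2 : ℝ) : ℂ)⁻¹ *
    ((![!![1, 0; 0, 1],
        !![0, Complex.I; Complex.I, 0],
        !![0, -1; 1, 0],
        !![Complex.I, 0; 0, -Complex.I]] : Fin 4 → Matrix (Fin 2) (Fin 2) ℂ) i) ab.1 ab.2

/-- The null hypothesis: both samples are in the state `φ⁰`. -/
def nullStates : Set (Matrix Pair Pair ℂ) :=
  {ketbra (phi 0) ⊗ₖ ketbra (phi 0)}

/-- The alternative hypothesis: two independent samples of a state different from `φ⁰`. -/
def altStates : Set (Matrix Pair Pair ℂ) :=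
  {ρ | ∃ σ : Matrix Sample Sample ℂ, IsDensity σ ∧ σ ≠ ketbra (phi 0) ∧ ρ = σ ⊗ₖ σ}

/-! ### Locality -/

/-- The operator on the two samples that acts as `M` on `A₁ ⊗ A₂`. -/
def onA (M : Matrix (Fin 2 × Fin 2) (Fin 2 × Fin 2) ℂ) : Matrix Pair Pair ℂ :=
  Matrix.of fun r c =>
    if r.1.2 = c.1.2 ∧ r.2.2 = c.2.2 then M (r.1.1, r.2.1) (c.1.1, c.2.1) else 0

/-- The operator on the two samples that acts as `M` on `B₁ ⊗ B₂`. -/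
def onB (M : Matrix (Fin 2 × Fin 2) (Fin 2 × Fin 2) ℂ) : Matrix Pair Pair ℂ :=
  Matrix.of fun r c =>
    if r.1.1 = c.1.1 ∧ r.2.1 = c.2.1 then M (r.1.2, r.2.2) (c.1.2, c.2.2) else 0

/-- The two parties `A = A₁ ⊗ A₂` and `B = B₁ ⊗ B₂`. -/
def abParties : Fin 2 → Set (Matrix Pair Pair ℂ) :=
  ![Set.range onA, Set.range onB]

/-- The two samples `A₁ ⊗ B₁` and `A₂ ⊗ B₂`, as parties. -/
def sampleParties : Fin 2 → Set (Matrix Pair Pair ℂ) :=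
  ![Set.range fun M : Matrix Sample Sample ℂ => M ⊗ₖ (1 : Matrix Sample Sample ℂ),
    Set.range fun M : Matrix Sample Sample ℂ => (1 : Matrix Sample Sample ℂ) ⊗ₖ M]

/-- The four qubits `A₁`, `B₁`, `A₂`, `B₂`, as parties. -/
def qubitParties : Fin 4 → Set (Matrix Pair Pair ℂ) :=
  ![Set.range fun M : Matrix (Fin 2) (Fin 2) ℂ =>
      (M ⊗ₖ (1 : Matrix (Fin 2) (Fin 2) ℂ)) ⊗ₖ (1 : Matrix Sample Sample ℂ),
    Set.range fun M : Matrix (Fin 2) (Fin 2) ℂ =>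
      ((1 : Matrix (Fin 2) (Fin 2) ℂ) ⊗ₖ M) ⊗ₖ (1 : Matrix Sample Sample ℂ),
    Set.range fun M : Matrix (Fin 2) (Fin 2) ℂ =>
      (1 : Matrix Sample Sample ℂ) ⊗ₖ (M ⊗ₖ (1 : Matrix (Fin 2) (Fin 2) ℂ)),
    Set.range fun M : Matrix (Fin 2) (Fin 2) ℂ =>
      (1 : Matrix Sample Sample ℂ) ⊗ₖ ((1 : Matrix (Fin 2) (Fin 2) ℂ) ⊗ₖ M)]

/-- LOCC between `A` and `B`. -/
def IsABLocal (T : Matrix Pair Pair ℂ) : Prop := IsLOCC abParties T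

/-- LOCC between the first and the second sample. -/
def IsSamplewiseLocal (T : Matrix Pair Pair ℂ) : Prop := IsLOCC sampleParties T

/-- Both localities in one and the same protocol: LOCC between `A₁`, `B₁`, `A₂` and `B₂`. -/
def IsJointlyLocal (T : Matrix Pair Pair ℂ) : Prop := IsLOCC qubitParties T

/-! ### Invariance -/

/-- The V-action `U ⊗ conj U ⊗ U ⊗ conj U`. -/
def vAction (g : Matrix (Fin 2) (Fin 2) ℂ) : Matrix Pair Pair ℂ :=
  (g ⊗ₖ g.map star) ⊗ₖ (g ⊗ₖ g.map star)

/-- Invariance under the V-action of `SU(2)`. -/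
def IsVInvariant (T : Matrix Pair Pair ℂ) : Prop :=
  ∀ g ∈ Matrix.specialUnitaryGroup (Fin 2) ℂ, (vAction g)ᴴ * T * vAction g = T

/-- The AB-transposition, which maps `|i⟩|j⟩|k⟩|l⟩` (in the order `A₁, B₁, A₂, B₂`) to
`(-1)^(i+j+k+l) |1-j⟩|1-i⟩|1-l⟩|1-k⟩`. -/
def abTransposition : Matrix Pair Pair ℂ :=
  Matrix.of fun r c =>
    if r = ((1 - c.1.2, 1 - c.1.1), (1 - c.2.2, 1 - c.2.1)) then
      (-1 : ℂ) ^ ((c.1.1 : ℕ) + (c.1.2 : ℕ) + (c.2.1 : ℕ) + (c.2.2 : ℕ))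
    else 0

/-- Invariance under the AB-transposition. -/
def IsABInvariant (T : Matrix Pair Pair ℂ) : Prop :=
  abTranspositionᴴ * T * abTransposition = T

/-- Invariance under the exchange of the two samples. -/
def IsSampleSymmetric (T : Matrix Pair Pair ℂ) : Prop :=
  T.submatrix Prod.swap Prod.swap = T

/-- Termwise AB-covariance: `T` is a sum of products of rank-one projections such that in every
term the projections on `A` and `B` of the same sample are transposes (equivalently, complex
conjugates) of each other, which is expressed by `Tr (M_A M_Bᵀ) = 1`. -/
def IsTermwiseABCovariant (T : Matrix Pair Pair ℂ) : Prop :=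
  ∃ (m : ℕ) (p : Fin m → ℝ) (MA₁ MB₁ MA₂ MB₂ : Fin m → Matrix (Fin 2) (Fin 2) ℂ),
    (∀ i, 0 ≤ p i) ∧
    (∀ i, IsRankOneProj (MA₁ i) ∧ IsRankOneProj (MB₁ i) ∧
      IsRankOneProj (MA₂ i) ∧ IsRankOneProj (MB₂ i)) ∧
    T = ∑ i, ((p i : ℝ) : ℂ) • ((MA₁ i ⊗ₖ MB₁ i) ⊗ₖ (MA₂ i ⊗ₖ MB₂ i)) ∧
    ∀ i, (MA₁ i * (MB₁ i)ᵀ).trace = 1 ∧ (MA₂ i * (MB₂ i)ᵀ).trace = 1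

/-! ### The test -/

/-- The orthonormal basis `e^{ij} = φ^i ⊗ φ^j` of the two samples. -/
def eVec (i j : Fin 4) : Pair → ℂ := fun q => phi i q.1 * phi j q.2

/-- The projection onto the span of the `e^{ii}` and `e^{ij} + e^{ji}`, `1 ≤ i < j ≤ 3`. -/
def K6plus : Matrix Pair Pair ℂ :=
  ketbra (eVec 1 1) + ketbra (eVec 2 2) + ketbra (eVec 3 3) +
    (1 / 2 : ℂ) • (ketbra (eVec 1 2 + eVec 2 1) + ketbra (eVec 2 3 + eVec 3 2) + ketbra (eVec 3 1 + eVec 1 3))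

/-- The projection onto the line of `e^{11} + e^{22} + e^{33}`. -/
def K1plus : Matrix Pair Pair ℂ :=
  (1 / 3 : ℂ) • ketbra (eVec 1 1 + eVec 2 2 + eVec 3 3)

/-- The projection onto the orthogonal complement of `K1plus` in `K6plus`. -/
def K5plus : Matrix Pair Pair ℂ := K6plus - K1plus

/-- The projection onto the span of the `e^{ij} - e^{ji}`, `1 ≤ i < j ≤ 3`. -/
def K3minus : Matrix Pair Pair ℂ :=
  (1 / 2 : ℂ) • (ketbra (eVec 1 2 - eVec 2 1) + ketbra (eVec 2 3 - eVec 3 2) + ketbra (eVec 3 1 - eVec 1 3))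

/-- The projection onto the span of the `e^{0i} + e^{i0}`, `1 ≤ i ≤ 3`. -/
def L3plus : Matrix Pair Pair ℂ :=
  (1 / 2 : ℂ) • (ketbra (eVec 0 1 + eVec 1 0) + ketbra (eVec 0 2 + eVec 2 0) + ketbra (eVec 0 3 + eVec 3 0))

/-- The projection onto the span of the `e^{0i} - e^{i0}`, `1 ≤ i ≤ 3`. -/
def L3minus : Matrix Pair Pair ℂ :=
  (1 / 2 : ℂ) • (ketbra (eVec 0 1 - eVec 1 0) + ketbra (eVec 0 2 - eVec 2 0) + ketbra (eVec 0 3 - eVec 3 0))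

/-- The test `T₀^V`. -/
def testV : Matrix Pair Pair ℂ :=
  (1 / 10 : ℂ) • K5plus + (1 / 3 : ℂ) • L3plus + ketbra (phi 0) ⊗ₖ ketbra (phi 0)
    + (1 / 6 : ℂ) • K3minus + (1 / 3 : ℂ) • L3minus

/-! ### The type 2 error -/

/-- The matrix elements `x_{ij} = ⟨φ^i| σ |φ^j⟩`. -/
def xEl (σ : Matrix Sample Sample ℂ) (i j : Fin 4) : ℂ :=
  star (phi i) ⬝ᵥ (σ *ᵥ phi j)

/-- The vector `v = (x₁₁ - 1/2, x₂₂ - 1/2, x₃₃ - 1/2)`; the diagonal elements of a density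
matrix are real. -/
def vVec (σ : Matrix Sample Sample ℂ) : Fin 3 → ℝ :=
  ![(xEl σ 1 1).re - 1 / 2, (xEl σ 2 2).re - 1 / 2, (xEl σ 3 3).re - 1 / 2]

/-- The matrix `Z`. -/
def zMat : Matrix (Fin 3) (Fin 3) ℝ :=
  (1 / 15 : ℝ) • !![6, 7, 7; 7, 6, 7; 7, 7, 6]

end EntTest

end

open EntTest

/-!
Both halves of the theorem become transparent on the Bloch sphere. A rank-one projection
`M = qubit x` is given by a unit vector `x : Fin 3 → ℝ`, and termwise AB-covariance forces the
projection on `B` to be `Mᵀ` (`exists_twin`). So a termwise AB-covariant `T` is a finite weighted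
ensemble of pairs `(x, y)` of Bloch vectors: `T = ∑ p • twin x ⊗ twin y`, where
`twin x = qubit x ⊗ (qubit x)ᵀ` is the projection onto
`(φ⁰ - √-1 (x₀ φ¹ + x₁ φ² + x₂ φ³)) / √2` (`twin_eq_sum`).

*Optimality.* The type 2 error of `T` at `σ ⊗ σ` is the ensemble mean of `f x * f y`, where
`f x = Tr (σ twin x)` is a quadratic function of `x` (`trace_mul_twin`). V-invariance makes the
means of products of quadratic functions invariant under rotations
(`IsVInvariant.ensemble_comp`), which leaves few free moments: half-turns about the axes, a cyclic
permutation of the axes and one rotation by an oblique angle suffice to see this. Level zero means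
that `T` fixes `φ⁰ ⊗ φ⁰` (`mulVec_eVec_zero_zero`); hence the total weight is `4` and the mean of
`x ⬝ y` vanishes. The error is then a nondecreasing affine function of the one remaining parameter,
the mean of `(x ⬝ y) ^ 2`, and its value when that mean is zero is the error of `testV`
(`IsRotationInvariant.quadratic_le_ensemble`, `typeTwoError_testV_le`).

*Membership in the class.* The optimal ensembles therefore have `x ⬝ y = 0`. A finite one consists
of pairs of coordinate axes and pairs of diagonals in coordinate planes, with weights `1 / 10` and
`1 / 15` and all signs (`testV_eq_sum_frame`). It gives an LOCC protocol between the four qubits: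
choose the axes at random, measure every qubit along its axis, and keep the null hypothesis if the
outcomes agree within both samples (`isJointlyLocal_agree`). The V-invariance and AB-invariance of
`testV` both follow as it is a combination of products of `|φ⁰⟩⟨φ⁰|` and its complement, of the
exchange of the samples, and of the projection onto the line of `e¹¹ + e²² + e³³` (`conj_testV`).
-/

noncomputable section

namespace EntTest

/-! ### Protocols with local operations and classical communication -/

section LOCC

variable {n : Type} [Fintype n] [DecidableEq n]

/-- Merging parties only enlarges the set of protocols. -/
theorem IsLOCC.coarsen {P P' : Type} {loc : P → Set (Matrix n n ℂ)}
    {loc' : P' → Set (Matrix n n ℂ)} (f : P → P') (hf : ∀ p, loc p ⊆ loc' (f p))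
    {T : Matrix n n ℂ} (hT : IsLOCC loc T) : IsLOCC loc' T := by
  induction hT with
  | outcomeZero => exact .outcomeZero
  | outcomeOne => exact .outcomeOne
  | measure p m E hloc hsum T _ ih =>
    exact .measure (f p) m E (fun x => hf p (hloc x)) hsum T ih

theorem IsLOCC.isTest {P : Type} {loc : P → Set (Matrix n n ℂ)} {T : Matrix n n ℂ}
    (hT : IsLOCC loc T) : IsTest T := by
  induction hT with
  | outcomeZero => exact ⟨.one, by simpa using PosSemidef.zero⟩
  | outcomeOne => exact ⟨.zero, by simpa using PosSemidef.one⟩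
  | measure p m E hloc hsum T _ ih =>
    refine ⟨posSemidef_sum _ fun x _ => (ih x).1.conjTranspose_mul_mul_same _, ?_⟩
    have h : 1 - ∑ x, (E x)ᴴ * T x * E x = ∑ x, (E x)ᴴ * (1 - T x) * E x := by
      simp only [mul_sub, sub_mul, mul_one, Finset.sum_sub_distrib, hsum]
    rw [h]
    exact posSemidef_sum _ fun x _ => (ih x).2.conjTranspose_mul_mul_same _

/-- Random choice of a protocol: the Kraus operators are multiples of the identity. -/
theorem IsLOCC.mixture {P ι : Type} [Fintype ι] {loc : P → Set (Matrix n n ℂ)} (p : P)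
    (hp : ∀ c : ℂ, c • (1 : Matrix n n ℂ) ∈ loc p) (w : ι → ℝ) (hw : ∀ x, 0 ≤ w x)
    (hw1 : ∑ x, w x = 1) (T : ι → Matrix n n ℂ) (hT : ∀ x, IsLOCC loc (T x)) :
    IsLOCC loc (∑ x, (w x : ℂ) • T x) := by
  have hsq : ∀ x, (starRingEnd ℂ) (Real.sqrt (w x) : ℂ) * (Real.sqrt (w x) : ℂ) = (w x : ℂ) := by
    intro x
    rw [Complex.conj_ofReal, ← Complex.ofReal_mul, Real.mul_self_sqrt (hw x)]
  let e := (Fintype.equivFin ι).symm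
  have h := IsLOCC.measure (loc := loc) p (Fintype.card ι)
    (fun x => (Real.sqrt (w (e x)) : ℂ) • (1 : Matrix n n ℂ)) (fun x => hp _)
    (by
      have h1 : ∑ x, (w (e x) : ℂ) = 1 := by
        rw [Equiv.sum_comp e fun x => (w x : ℂ)]
        exact_mod_cast hw1
      simp only [conjTranspose_smul, conjTranspose_one, smul_mul_smul_comm, mul_one,
        RCLike.star_def, hsq, ← Finset.sum_smul, h1, one_smul])
    (fun x => T (e x)) (fun x => hT _)
  rw [← Equiv.sum_comp e fun x => (w x : ℂ) • T x]
  convert h using 2 with x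
  simp only [conjTranspose_smul, conjTranspose_one, smul_mul_assoc, mul_smul_comm, mul_one,
    one_mul, smul_smul, RCLike.star_def]
  rw [mul_comm, hsq]

/-- A local projective measurement with two outcomes, followed by a protocol for each outcome. -/
theorem IsLOCC.projective {P : Type} {loc : P → Set (Matrix n n ℂ)} (p : P)
    {E F T S : Matrix n n ℂ} (hE : E ∈ loc p) (hF : F ∈ loc p) (hEF : E + F = 1)
    (hEh : E.IsHermitian) (hFh : F.IsHermitian) (hEE : E * E = E) (hFF : F * F = F)
    (hT : IsLOCC loc T) (hS : IsLOCC loc S) : IsLOCC loc (E * T * E + F * S * F) := by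
  have h := IsLOCC.measure (loc := loc) p 2 ![E, F]
    (by intro x; fin_cases x <;> simpa)
    (by simp [hEh.eq, hFh.eq, hEE, hFF, hEF]) ![T, S]
    (by intro x; fin_cases x <;> simpa)
  simpa [hEh.eq, hFh.eq] using h

end LOCC

theorem IsJointlyLocal.isABLocal {T : Matrix Pair Pair ℂ} (hT : IsJointlyLocal T) :
    IsABLocal T := by
  refine IsLOCC.coarsen ![0, 1, 0, 1] (fun p => ?_) hT
  fin_cases p <;> rintro _ ⟨M, rfl⟩
  · refine ⟨M ⊗ₖ 1, ?_⟩
    ext ⟨⟨a, b⟩, c, d⟩ ⟨⟨a', b'⟩, c', d'⟩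
    by_cases h1 : b = b' <;> by_cases h2 : d = d' <;>
      simp [onA, kroneckerMap_apply, one_apply, h1, h2]
  · refine ⟨M ⊗ₖ 1, ?_⟩
    ext ⟨⟨a, b⟩, c, d⟩ ⟨⟨a', b'⟩, c', d'⟩
    by_cases h1 : a = a' <;> by_cases h2 : c = c' <;>
      simp [onB, kroneckerMap_apply, one_apply, h1, h2]
  · refine ⟨1 ⊗ₖ M, ?_⟩
    ext ⟨⟨a, b⟩, c, d⟩ ⟨⟨a', b'⟩, c', d'⟩
    by_cases h1 : b = b' <;> by_cases h2 : d = d' <;>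
      simp [onA, kroneckerMap_apply, one_apply, h1, h2]
  · refine ⟨1 ⊗ₖ M, ?_⟩
    ext ⟨⟨a, b⟩, c, d⟩ ⟨⟨a', b'⟩, c', d'⟩
    by_cases h1 : a = a' <;> by_cases h2 : c = c' <;>
      simp [onB, kroneckerMap_apply, one_apply, h1, h2]

theorem IsJointlyLocal.isSamplewiseLocal {T : Matrix Pair Pair ℂ} (hT : IsJointlyLocal T) :
    IsSamplewiseLocal T := by
  refine IsLOCC.coarsen ![0, 0, 1, 1] (fun p => ?_) hT
  fin_cases p <;> rintro _ ⟨M, rfl⟩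
  exacts [⟨M ⊗ₖ 1, rfl⟩, ⟨1 ⊗ₖ M, rfl⟩, ⟨M ⊗ₖ 1, rfl⟩, ⟨1 ⊗ₖ M, rfl⟩]

/-! ### Rank-one projections on a qubit and the Bloch sphere -/

/-- The operator `(1 + x₀ σ_x - x₁ σ_y + x₂ σ_z) / 2` on a qubit. The sign of the second
coordinate is chosen so that the coordinates match the vectors `φ¹, φ², φ³`. -/
def qubit (x : Fin 3 → ℝ) : Matrix (Fin 2) (Fin 2) ℂ :=
  !![(1 + x 2) / 2, (x 0 + Complex.I * x 1) / 2; (x 0 - Complex.I * x 1) / 2, (1 - x 2) / 2]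

/-- The operator `M ⊗ Mᵀ` on one sample, where `M` is the qubit operator with Bloch
vector `x`. -/
def twin (x : Fin 3 → ℝ) : Matrix Sample Sample ℂ := qubit x ⊗ₖ (qubit x)ᵀ

/-- `x` lies on the Bloch sphere; `Fin 3 → ℝ` itself carries the supremum norm. -/
def IsUnitVec (x : Fin 3 → ℝ) : Prop := x 0 ^ 2 + x 1 ^ 2 + x 2 ^ 2 = 1

theorem IsUnitVec.neg {x : Fin 3 → ℝ} (hx : IsUnitVec x) : IsUnitVec (-x) := by
  simpa [IsUnitVec] using hx

theorem qubit_isHermitian (x : Fin 3 → ℝ) : (qubit x).IsHermitian := by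
  ext i j
  fin_cases i <;> fin_cases j <;> simp [qubit, sub_eq_add_neg]

theorem qubit_add_neg (x : Fin 3 → ℝ) : qubit x + qubit (-x) = 1 := by
  ext i j
  fin_cases i <;> fin_cases j <;> simp [qubit, one_apply] <;> ring

theorem IsUnitVec.complex {x : Fin 3 → ℝ} (hx : IsUnitVec x) :
    (x 0 : ℂ) ^ 2 + (x 1 : ℂ) ^ 2 + (x 2 : ℂ) ^ 2 = 1 := by
  exact_mod_cast congrArg (fun r : ℝ => (r : ℂ)) hx

theorem qubit_mul_self {x : Fin 3 → ℝ} (hx : IsUnitVec x) : qubit x * qubit x = qubit x := by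
  have h := hx.complex
  ext i j
  fin_cases i <;> fin_cases j <;> simp [qubit, mul_apply, Fin.sum_univ_two] <;> ring_nf <;>
    simp only [Complex.I_sq] <;> linear_combination (1 / 4 : ℂ) * h

theorem rank_eq_trace_of_mul_self {m : Type} [Fintype m] [DecidableEq m] {M : Matrix m m ℂ}
    (hM : M * M = M) : (M.rank : ℂ) = M.trace := by
  have h : IsIdempotentElem (toLin' M) := by
    rw [IsIdempotentElem, Module.End.mul_eq_comp, ← toLin'_mul, hM]
  rw [← trace_toLin'_eq, (LinearMap.IsIdempotentElem.isProj_range _ h).trace]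
  rfl

theorem qubit_isRankOneProj {x : Fin 3 → ℝ} (hx : IsUnitVec x) : IsRankOneProj (qubit x) := by
  refine ⟨qubit_isHermitian x, qubit_mul_self hx, ?_⟩
  have h := rank_eq_trace_of_mul_self (qubit_mul_self hx)
  have h2 : (qubit x).trace = 1 := by
    simp [qubit, trace_fin_two]; ring
  rw [h2] at h
  exact_mod_cast h

/-- Every rank-one projection on a qubit is given by a point of the Bloch sphere. -/
theorem IsRankOneProj.exists_qubit {M : Matrix (Fin 2) (Fin 2) ℂ} (hM : IsRankOneProj M) :
    ∃ x, IsUnitVec x ∧ M = qubit x := by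
  obtain ⟨hh, hi, hr⟩ := hM
  have ht := rank_eq_trace_of_mul_self hi
  rw [hr, trace_fin_two] at ht
  have h00 : (M 0 0).im = 0 := by
    have := congrArg Complex.im (hh.apply 0 0); simp at this; linarith
  have h11 : (M 1 1).im = 0 := by
    have := congrArg Complex.im (hh.apply 1 1); simp at this; linarith
  have h10r : (M 1 0).re = (M 0 1).re := by
    have := congrArg Complex.re (hh.apply 1 0); simp at this; linarith
  have h10i : (M 1 0).im = -(M 0 1).im := by
    have := congrArg Complex.im (hh.apply 1 0); simp at this; linarith
  have htr : (M 0 0).re + (M 1 1).re = 1 := by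
    have := congrArg Complex.re ht; simp at this; linarith
  have hsq : (M 0 0).re ^ 2 + (M 0 1).re ^ 2 + (M 0 1).im ^ 2 = (M 0 0).re := by
    have := congrArg (fun N : Matrix (Fin 2) (Fin 2) ℂ => (N 0 0).re) hi
    simp [mul_apply, Fin.sum_univ_two, h00, h10r, h10i] at this
    linarith
  refine ⟨![2 * (M 0 1).re, 2 * (M 0 1).im, (M 0 0).re - (M 1 1).re], ?_, ?_⟩
  · simp [IsUnitVec]
    rw [← sub_eq_iff_eq_add'.2 htr.symm]
    linear_combination 4 * hsq
  · ext i j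
    fin_cases i <;> fin_cases j <;> apply Complex.ext <;>
      simp [qubit, h00, h11, h10r, h10i] <;> linarith

theorem trace_qubit_mul_qubit (x y : Fin 3 → ℝ) :
    (qubit x * qubit y).trace = (1 + (x 0 * y 0 + x 1 * y 1 + x 2 * y 2) : ℝ) / 2 := by
  simp [qubit, trace_fin_two]
  ring_nf
  simp only [Complex.I_sq]
  ring

/-- Two rank-one projections `M`, `N` with `Tr (M Nᵀ) = 1` are transposes of each other. -/
theorem exists_twin {M N : Matrix (Fin 2) (Fin 2) ℂ} (hM : IsRankOneProj M)
    (hN : IsRankOneProj N) (h : (M * Nᵀ).trace = 1) : ∃ x, IsUnitVec x ∧ M ⊗ₖ N = twin x := by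
  obtain ⟨x, hx, rfl⟩ := hM.exists_qubit
  obtain ⟨y, hy, rfl⟩ := hN.exists_qubit
  -- transposition changes the sign of the second Bloch coordinate
  have hyt : (qubit y)ᵀ = qubit ![y 0, -y 1, y 2] := by
    ext i j
    fin_cases i <;> fin_cases j <;> simp [qubit, sub_eq_add_neg]
  rw [hyt, trace_qubit_mul_qubit] at h
  have hr : (1 + (x 0 * y 0 + x 1 * -y 1 + x 2 * y 2) : ℝ) / 2 = 1 := by
    simpa using congrArg Complex.re h
  unfold IsUnitVec at hx hy
  -- the squared distance of the two Bloch vectors vanishes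
  have hd : (x 0 - y 0) ^ 2 + (x 1 + y 1) ^ 2 + (x 2 - y 2) ^ 2 = 0 := by
    linear_combination hx + hy - 4 * hr
  have h0 : y 0 = x 0 := by
    nlinarith [sq_nonneg (x 0 - y 0), sq_nonneg (x 1 + y 1),
      sq_nonneg (x 2 - y 2)]
  have h1 : y 1 = -x 1 := by
    nlinarith [sq_nonneg (x 0 - y 0), sq_nonneg (x 1 + y 1),
      sq_nonneg (x 2 - y 2)]
  have h2 : y 2 = x 2 := by
    nlinarith [sq_nonneg (x 0 - y 0), sq_nonneg (x 1 + y 1),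
      sq_nonneg (x 2 - y 2)]
  refine ⟨x, hx, ?_⟩
  rw [twin, ← transpose_transpose (qubit y), hyt, h0, h1, h2, neg_neg]
  congr 3
  ext i
  fin_cases i <;> rfl

/-! ### Termwise AB-covariant tests -/

theorem IsTermwiseABCovariant.zero : IsTermwiseABCovariant 0 :=
  ⟨0, ![], ![], ![], ![], ![], by simp, by simp, by simp, by simp⟩

theorem IsTermwiseABCovariant.add {S T : Matrix Pair Pair ℂ} (hS : IsTermwiseABCovariant S)
    (hT : IsTermwiseABCovariant T) : IsTermwiseABCovariant (S + T) := by
  obtain ⟨m, p, A, B, C, D, hp, hr, rfl, ht⟩ := hS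
  obtain ⟨m', p', A', B', C', D', hp', hr', rfl, ht'⟩ := hT
  refine ⟨m + m', Fin.append p p', Fin.append A A', Fin.append B B', Fin.append C C',
    Fin.append D D', ?_, ?_, ?_, ?_⟩
  · intro i; induction i using Fin.addCases <;> simp [hp, hp']
  · intro i; induction i using Fin.addCases <;> simp [hr, hr']
  · simp [Fin.sum_univ_add]
  · intro i; induction i using Fin.addCases <;> simp [ht, ht']

theorem IsTermwiseABCovariant.smul {T : Matrix Pair Pair ℂ} (hT : IsTermwiseABCovariant T)
    {c : ℝ} (hc : 0 ≤ c) : IsTermwiseABCovariant ((c : ℂ) • T) := by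
  obtain ⟨m, p, A, B, C, D, hp, hr, rfl, ht⟩ := hT
  exact ⟨m, fun i => c * p i, A, B, C, D, fun i => mul_nonneg hc (hp i), hr,
    by simp only [Finset.smul_sum, smul_smul, Complex.ofReal_mul], ht⟩

theorem IsTermwiseABCovariant.sum {ι : Type} (s : Finset ι) {T : ι → Matrix Pair Pair ℂ}
    (hT : ∀ i ∈ s, IsTermwiseABCovariant (T i)) : IsTermwiseABCovariant (∑ i ∈ s, T i) :=
  Finset.sum_induction _ _ (fun _ _ => .add) .zero hT

theorem isTermwiseABCovariant_twin {x y : Fin 3 → ℝ} (hx : IsUnitVec x) (hy : IsUnitVec y) :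
    IsTermwiseABCovariant (twin x ⊗ₖ twin y) := by
  have hT : ∀ {z : Fin 3 → ℝ}, IsUnitVec z → IsRankOneProj (qubit z)ᵀ := fun {z} hz =>
    ⟨(qubit_isHermitian z).transpose, by rw [← transpose_mul, qubit_mul_self hz],
      by rw [rank_transpose, (qubit_isRankOneProj hz).2.2]⟩
  have ht : ∀ {z : Fin 3 → ℝ}, IsUnitVec z → (qubit z * (qubit z)ᵀᵀ).trace = 1 := fun {z} hz => by
    rw [transpose_transpose, qubit_mul_self hz]
    simp [qubit, trace_fin_two]; ring
  exact ⟨1, fun _ => 1, fun _ => qubit x, fun _ => (qubit x)ᵀ, fun _ => qubit y,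
    fun _ => (qubit y)ᵀ, by simp, fun _ => ⟨qubit_isRankOneProj hx, hT hx,
      qubit_isRankOneProj hy, hT hy⟩, by simp [twin], fun _ => ⟨ht hx, ht hy⟩⟩

/-- A termwise AB-covariant test is a finite positive combination of the operators
`twin x ⊗ twin y` with Bloch vectors `x` and `y`. -/
theorem IsTermwiseABCovariant.exists_twin {T : Matrix Pair Pair ℂ}
    (hT : IsTermwiseABCovariant T) :
    ∃ (m : ℕ) (p : Fin m → ℝ) (x y : Fin m → Fin 3 → ℝ), (∀ i, 0 ≤ p i) ∧
      (∀ i, IsUnitVec (x i)) ∧ (∀ i, IsUnitVec (y i)) ∧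
      T = ∑ i, (p i : ℂ) • (twin (x i) ⊗ₖ twin (y i)) := by
  obtain ⟨m, p, A, B, C, D, hp, hr, rfl, ht⟩ := hT
  choose x hx hx' using fun i => EntTest.exists_twin (hr i).1 (hr i).2.1 (ht i).1
  choose y hy hy' using fun i => EntTest.exists_twin (hr i).2.2.1 (hr i).2.2.2 (ht i).2
  exact ⟨m, p, x, y, hp, hx, hy, by simp only [hx', hy']⟩

/-! ### Comparing the outcomes along an axis on each sample -/

/-- The event that the measurements of `A` along the axis of `x` and of `B` along the
transposed axis have the same outcome. -/
def agree (x : Fin 3 → ℝ) : Matrix Sample Sample ℂ := twin x + twin (-x)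

theorem isTermwiseABCovariant_agree {x y : Fin 3 → ℝ} (hx : IsUnitVec x) (hy : IsUnitVec y) :
    IsTermwiseABCovariant (agree x ⊗ₖ agree y) := by
  rw [agree, agree, add_kronecker, kronecker_add, kronecker_add]
  exact ((isTermwiseABCovariant_twin hx hy).add (isTermwiseABCovariant_twin hx hy.neg)).add
    ((isTermwiseABCovariant_twin hx.neg hy).add (isTermwiseABCovariant_twin hx.neg hy.neg))

/-- The four parties measure one after another; the outcome `0` is announced if the outcomes
agree within each sample. -/
theorem isJointlyLocal_agree {x y : Fin 3 → ℝ} (hx : IsUnitVec x) (hy : IsUnitVec y) :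
    IsJointlyLocal (agree x ⊗ₖ agree y) := by
  have hneg : ∀ z : Fin 3 → ℝ, (qubit z)ᵀ + (qubit (-z))ᵀ = 1 := fun z => by
    rw [← transpose_add, qubit_add_neg, transpose_one]
  have hT : ∀ {z : Fin 3 → ℝ}, IsUnitVec z → (qubit z)ᵀ * (qubit z)ᵀ = (qubit z)ᵀ :=
    fun {z} hz => by rw [← transpose_mul, qubit_mul_self hz]
  -- the protocol is built backwards, from the last measurement to the first
  have hB2 : ∀ {z : Fin 3 → ℝ}, IsUnitVec z →
      IsJointlyLocal ((1 : Matrix Sample Sample ℂ) ⊗ₖ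
        ((1 : Matrix (Fin 2) (Fin 2) ℂ) ⊗ₖ (qubit z)ᵀ)) := by
    intro z hz
    have h := IsLOCC.projective (loc := qubitParties) 3
      (E := (1 : Matrix Sample Sample ℂ) ⊗ₖ ((1 : Matrix (Fin 2) (Fin 2) ℂ) ⊗ₖ (qubit z)ᵀ))
      (F := (1 : Matrix Sample Sample ℂ) ⊗ₖ ((1 : Matrix (Fin 2) (Fin 2) ℂ) ⊗ₖ (qubit (-z))ᵀ))
      ⟨_, rfl⟩ ⟨_, rfl⟩
      (by simp only [← kronecker_add, hneg, one_kronecker_one])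
      (by simp only [IsHermitian, conjTranspose_kronecker, conjTranspose_one,
        (qubit_isHermitian _).transpose.eq])
      (by simp only [IsHermitian, conjTranspose_kronecker, conjTranspose_one,
        (qubit_isHermitian _).transpose.eq])
      (by simp only [← mul_kronecker_mul, one_mul, hT hz])
      (by simp only [← mul_kronecker_mul, one_mul, hT hz.neg]) .outcomeZero .outcomeOne
    simpa only [IsJointlyLocal, mul_one, mul_zero, zero_mul, add_zero, ← mul_kronecker_mul,
      one_mul, hT hz] using h
  have hS2 : IsJointlyLocal ((1 : Matrix Sample Sample ℂ) ⊗ₖ agree y) := by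
    have h := IsLOCC.projective (loc := qubitParties) 2
      (E := (1 : Matrix Sample Sample ℂ) ⊗ₖ (qubit y ⊗ₖ (1 : Matrix (Fin 2) (Fin 2) ℂ)))
      (F := (1 : Matrix Sample Sample ℂ) ⊗ₖ (qubit (-y) ⊗ₖ (1 : Matrix (Fin 2) (Fin 2) ℂ)))
      ⟨_, rfl⟩ ⟨_, rfl⟩
      (by simp only [← kronecker_add, ← add_kronecker, qubit_add_neg, one_kronecker_one])
      (by simp only [IsHermitian, conjTranspose_kronecker, conjTranspose_one,
        (qubit_isHermitian _).eq])
      (by simp only [IsHermitian, conjTranspose_kronecker, conjTranspose_one,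
        (qubit_isHermitian _).eq])
      (by simp only [← mul_kronecker_mul, one_mul, qubit_mul_self hy])
      (by simp only [← mul_kronecker_mul, one_mul, qubit_mul_self hy.neg]) (hB2 hy) (hB2 hy.neg)
    simpa only [IsJointlyLocal, agree, twin, ← mul_kronecker_mul, one_mul, mul_one,
      qubit_mul_self hy, qubit_mul_self hy.neg, ← kronecker_add] using h
  have hB1 : ∀ {z : Fin 3 → ℝ}, IsUnitVec z →
      IsJointlyLocal (((1 : Matrix (Fin 2) (Fin 2) ℂ) ⊗ₖ (qubit z)ᵀ) ⊗ₖ agree y) := by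
    intro z hz
    have h := IsLOCC.projective (loc := qubitParties) 1
      (E := ((1 : Matrix (Fin 2) (Fin 2) ℂ) ⊗ₖ (qubit z)ᵀ) ⊗ₖ (1 : Matrix Sample Sample ℂ))
      (F := ((1 : Matrix (Fin 2) (Fin 2) ℂ) ⊗ₖ (qubit (-z))ᵀ) ⊗ₖ (1 : Matrix Sample Sample ℂ))
      ⟨_, rfl⟩ ⟨_, rfl⟩
      (by simp only [← add_kronecker, ← kronecker_add, hneg, one_kronecker_one])
      (by simp only [IsHermitian, conjTranspose_kronecker, conjTranspose_one,
        (qubit_isHermitian _).transpose.eq])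
      (by simp only [IsHermitian, conjTranspose_kronecker, conjTranspose_one,
        (qubit_isHermitian _).transpose.eq])
      (by simp only [← mul_kronecker_mul, one_mul, hT hz])
      (by simp only [← mul_kronecker_mul, one_mul, hT hz.neg]) hS2 .outcomeOne
    simpa only [IsJointlyLocal, mul_one, mul_zero, zero_mul, add_zero, ← mul_kronecker_mul,
      one_mul, hT hz] using h
  have h := IsLOCC.projective (loc := qubitParties) 0
    (E := (qubit x ⊗ₖ (1 : Matrix (Fin 2) (Fin 2) ℂ)) ⊗ₖ (1 : Matrix Sample Sample ℂ))
    (F := (qubit (-x) ⊗ₖ (1 : Matrix (Fin 2) (Fin 2) ℂ)) ⊗ₖ (1 : Matrix Sample Sample ℂ))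
    ⟨_, rfl⟩ ⟨_, rfl⟩
    (by simp only [← add_kronecker, qubit_add_neg, one_kronecker_one])
    (by simp only [IsHermitian, conjTranspose_kronecker, conjTranspose_one,
        (qubit_isHermitian _).eq])
    (by simp only [IsHermitian, conjTranspose_kronecker, conjTranspose_one,
        (qubit_isHermitian _).eq])
    (by simp only [← mul_kronecker_mul, one_mul, qubit_mul_self hx])
    (by simp only [← mul_kronecker_mul, one_mul, qubit_mul_self hx.neg]) (hB1 hx) (hB1 hx.neg)
  simpa only [IsJointlyLocal, agree, twin, ← mul_kronecker_mul, one_mul, mul_one,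
    qubit_mul_self hx, qubit_mul_self hx.neg, ← add_kronecker] using h

/-! ### The operators `|φⁱ⟩⟨φʲ|` and the expansion of the test -/

/-- The operator `|φⁱ⟩⟨φʲ|` on one sample. -/
def phiUnit (i j : Fin 4) : Matrix Sample Sample ℂ := vecMulVec (phi i) (star (phi j))

theorem inv_sqrt_two_mul_self :
    ((Real.sqrt 2 : ℝ) : ℂ)⁻¹ * ((Real.sqrt 2 : ℝ) : ℂ)⁻¹ = 1 / 2 := by
  rw [← mul_inv, ← Complex.ofReal_mul, Real.mul_self_sqrt (by norm_num)]
  norm_num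

theorem star_phi_dotProduct_phi (i j : Fin 4) :
    star (phi i) ⬝ᵥ phi j = if i = j then 1 else 0 := by
  have h := inv_sqrt_two_mul_self
  fin_cases i <;> fin_cases j <;>
    simp [dotProduct, phi, Fintype.sum_prod_type, Fin.sum_univ_two] <;>
    ring_nf <;> simp [pow_two, Complex.I_mul_I, h]

theorem phiUnit_mul (i j k l : Fin 4) :
    phiUnit i j * phiUnit k l = if j = k then phiUnit i l else 0 := by
  rw [phiUnit, phiUnit, vecMulVec_mul_vecMulVec, star_phi_dotProduct_phi]
  split <;> simp [phiUnit]

theorem sum_phiUnit : phiUnit 0 0 + phiUnit 1 1 + phiUnit 2 2 + phiUnit 3 3 = 1 := by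
  have h := inv_sqrt_two_mul_self
  ext ⟨a, b⟩ ⟨c, d⟩
  fin_cases a <;> fin_cases b <;> fin_cases c <;> fin_cases d <;>
    simp [phiUnit, vecMulVec_apply, phi, one_apply] <;>
    ring_nf <;> simp [pow_two, Complex.I_mul_I, h] <;> norm_num

theorem trace_mul_phiUnit (σ : Matrix Sample Sample ℂ) (i j : Fin 4) :
    (σ * phiUnit i j).trace = xEl σ j i := by
  rw [phiUnit, mul_vecMulVec, trace_vecMulVec, xEl, dotProduct_comm]

theorem trace_phiUnit (i j : Fin 4) : (phiUnit i j).trace = if i = j then 1 else 0 := by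
  rw [phiUnit, trace_vecMulVec, dotProduct_comm, star_phi_dotProduct_phi]
  simp only [eq_comm]

theorem vecMulVec_eVec (i j k l : Fin 4) :
    vecMulVec (eVec i j) (star (eVec k l)) = phiUnit i k ⊗ₖ phiUnit j l := by
  ext r c
  simp [vecMulVec_apply, eVec, phiUnit, kroneckerMap_apply]
  ring

/-- The test in terms of the operators `|φⁱ⟩⟨φʲ|`. -/
theorem testV_eq_phiUnit : testV =
    phiUnit 0 0 ⊗ₖ phiUnit 0 0 +
    (1 / 3 : ℂ) • (phiUnit 0 0 ⊗ₖ (phiUnit 1 1 + phiUnit 2 2 + phiUnit 3 3) +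
      (phiUnit 1 1 + phiUnit 2 2 + phiUnit 3 3) ⊗ₖ phiUnit 0 0) +
    (2 / 15 : ℂ) • ((phiUnit 1 1 + phiUnit 2 2 + phiUnit 3 3) ⊗ₖ
      (phiUnit 1 1 + phiUnit 2 2 + phiUnit 3 3)) -
    (1 / 30 : ℂ) • ((phiUnit 1 1 ⊗ₖ phiUnit 1 1 + phiUnit 1 2 ⊗ₖ phiUnit 2 1
        + phiUnit 1 3 ⊗ₖ phiUnit 3 1 + phiUnit 2 1 ⊗ₖ phiUnit 1 2 + phiUnit 2 2 ⊗ₖ phiUnit 2 2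
        + phiUnit 2 3 ⊗ₖ phiUnit 3 2 + phiUnit 3 1 ⊗ₖ phiUnit 1 3 + phiUnit 3 2 ⊗ₖ phiUnit 2 3
        + phiUnit 3 3 ⊗ₖ phiUnit 3 3)
      + (phiUnit 1 1 ⊗ₖ phiUnit 1 1 + phiUnit 1 2 ⊗ₖ phiUnit 1 2
        + phiUnit 1 3 ⊗ₖ phiUnit 1 3 + phiUnit 2 1 ⊗ₖ phiUnit 2 1 + phiUnit 2 2 ⊗ₖ phiUnit 2 2
        + phiUnit 2 3 ⊗ₖ phiUnit 2 3 + phiUnit 3 1 ⊗ₖ phiUnit 3 1 + phiUnit 3 2 ⊗ₖ phiUnit 3 2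
        + phiUnit 3 3 ⊗ₖ phiUnit 3 3)) := by
  simp only [testV, K5plus, K6plus, K1plus, L3plus, L3minus, K3minus, ketbra, star_add, star_sub,
    add_vecMulVec, vecMulVec_add, sub_vecMulVec, vecMulVec_sub, vecMulVec_eVec,
    kronecker_add, add_kronecker]
  rw [show vecMulVec (phi 0) (star (phi 0)) = phiUnit 0 0 from rfl]
  module

/-! ### Symmetries of the test -/

/-- The unnormalized vector `e¹¹ + e²² + e³³`. -/
def tripletSinglet : Pair → ℂ := eVec 1 1 + eVec 2 2 + eVec 3 3

theorem tripletSinglet_apply (q : Pair) : tripletSinglet q =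
    1 / 2 * ((1 : Matrix (Fin 2) (Fin 2) ℂ) q.1.1 q.1.2 *
      (1 : Matrix (Fin 2) (Fin 2) ℂ) q.2.1 q.2.2) -
    (1 : Matrix (Fin 2) (Fin 2) ℂ) q.1.1 q.2.2 *
      (1 : Matrix (Fin 2) (Fin 2) ℂ) q.2.1 q.1.2 := by
  obtain ⟨⟨a, b⟩, c, d⟩ := q
  have h := inv_sqrt_two_mul_self
  fin_cases a <;> fin_cases b <;> fin_cases c <;> fin_cases d <;>
    simp [tripletSinglet, eVec, phi] <;>
    ring_nf <;> simp [pow_two, Complex.I_mul_I, h] <;> norm_num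

theorem phi_zero_apply (q : Sample) :
    phi 0 q = ((Real.sqrt 2 : ℝ) : ℂ)⁻¹ * (1 : Matrix (Fin 2) (Fin 2) ℂ) q.1 q.2 := by
  obtain ⟨a, b⟩ := q
  fin_cases a <;> fin_cases b <;> simp [phi]

/-- The operator `∑ |φⁱφʲ⟩⟨φʲφⁱ|` over `i, j ≥ 1` is the sample exchange composed with `Q ⊗ Q`,
where `Q` is the projection onto the span of `φ¹, φ², φ³`. -/
theorem exchange_eq_submatrix :
    phiUnit 1 1 ⊗ₖ phiUnit 1 1 + phiUnit 1 2 ⊗ₖ phiUnit 2 1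
        + phiUnit 1 3 ⊗ₖ phiUnit 3 1 + phiUnit 2 1 ⊗ₖ phiUnit 1 2 + phiUnit 2 2 ⊗ₖ phiUnit 2 2
        + phiUnit 2 3 ⊗ₖ phiUnit 3 2 + phiUnit 3 1 ⊗ₖ phiUnit 1 3 + phiUnit 3 2 ⊗ₖ phiUnit 2 3
        + phiUnit 3 3 ⊗ₖ phiUnit 3 3 =
    ((1 - phiUnit 0 0) ⊗ₖ (1 - phiUnit 0 0)).submatrix Prod.swap id := by
  have hQ : 1 - phiUnit 0 0 = phiUnit 1 1 + phiUnit 2 2 + phiUnit 3 3 := by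
    rw [← sum_phiUnit]; abel
  rw [hQ]
  ext r c
  simp only [submatrix_apply, kroneckerMap_apply, Matrix.add_apply, phiUnit, vecMulVec_apply,
    Prod.fst_swap, Prod.snd_swap, id]
  ring

/-- The operator `∑ |φⁱφⁱ⟩⟨φʲφʲ|` over `i, j ≥ 1` has rank one. -/
theorem pairing_eq_vecMulVec :
    phiUnit 1 1 ⊗ₖ phiUnit 1 1 + phiUnit 1 2 ⊗ₖ phiUnit 1 2
        + phiUnit 1 3 ⊗ₖ phiUnit 1 3 + phiUnit 2 1 ⊗ₖ phiUnit 2 1 + phiUnit 2 2 ⊗ₖ phiUnit 2 2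
        + phiUnit 2 3 ⊗ₖ phiUnit 2 3 + phiUnit 3 1 ⊗ₖ phiUnit 3 1 + phiUnit 3 2 ⊗ₖ phiUnit 3 2
        + phiUnit 3 3 ⊗ₖ phiUnit 3 3 = vecMulVec tripletSinglet (star tripletSinglet) := by
  simp only [tripletSinglet, star_add, add_vecMulVec, vecMulVec_add, vecMulVec_eVec]
  abel

theorem conj_submatrix_swap (W : Matrix Sample Sample ℂ) (X : Matrix Pair Pair ℂ) :
    (W ⊗ₖ W)ᴴ * X.submatrix Prod.swap id * (W ⊗ₖ W) =
      ((W ⊗ₖ W)ᴴ * X * (W ⊗ₖ W)).submatrix Prod.swap id := by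
  have h : (W ⊗ₖ W)ᴴ = (W ⊗ₖ W)ᴴ.submatrix Prod.swap (Equiv.prodComm Sample Sample) := by
    ext r c
    simp [kroneckerMap_apply, mul_comm]
  have h2 : X.submatrix Prod.swap id = X.submatrix (Equiv.prodComm Sample Sample) id := rfl
  conv_lhs => rw [h, h2, submatrix_mul_equiv]
  rfl

/-- The test commutes with `W ⊗ W` if `W` is unitary, fixes `φ⁰` and `W ⊗ W` fixes
`e¹¹ + e²² + e³³`. -/
theorem conj_testV {W : Matrix Sample Sample ℂ} (hW : Wᴴ * W = 1)
    (h0 : Wᴴ *ᵥ phi 0 = phi 0) (hη : (W ⊗ₖ W)ᴴ *ᵥ tripletSinglet = tripletSinglet) :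
    (W ⊗ₖ W)ᴴ * testV * (W ⊗ₖ W) = testV := by
  have h00 : Wᴴ * phiUnit 0 0 * W = phiUnit 0 0 := by
    have h := congrArg star h0
    rw [star_mulVec, conjTranspose_conjTranspose] at h
    rw [phiUnit, mul_vecMulVec, vecMulVec_mul, h0, h]
  have hηη : (W ⊗ₖ W)ᴴ * vecMulVec tripletSinglet (star tripletSinglet) * (W ⊗ₖ W) =
      vecMulVec tripletSinglet (star tripletSinglet) := by
    have h := congrArg star hη
    rw [star_mulVec, conjTranspose_conjTranspose] at h
    rw [mul_vecMulVec, vecMulVec_mul, hη, h]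
  have hQ : Wᴴ * (1 - phiUnit 0 0) * W = 1 - phiUnit 0 0 := by
    rw [mul_sub, sub_mul, mul_one, hW, h00]
  have hQ' : phiUnit 1 1 + phiUnit 2 2 + phiUnit 3 3 = 1 - phiUnit 0 0 := by
    rw [← sum_phiUnit]; abel
  rw [testV_eq_phiUnit, exchange_eq_submatrix, pairing_eq_vecMulVec, hQ']
  simp only [mul_add, add_mul, mul_sub, sub_mul, mul_smul_comm, smul_mul_assoc,
    conj_submatrix_swap, hηη]
  simp only [conjTranspose_kronecker, ← mul_kronecker_mul, h00, hQ]

theorem conj_kronecker_mulVec_phi_zero (g : Matrix (Fin 2) (Fin 2) ℂ) (hg : g * gᴴ = 1) :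
    (g ⊗ₖ g.map star) *ᵥ phi 0 = phi 0 := by
  ext ⟨a, b⟩
  rw [phi_zero_apply (a, b), ← hg]
  simp [mulVec, dotProduct, phi_zero_apply, Fintype.sum_prod_type, Fin.sum_univ_two, mul_apply]
  ring

theorem vAction_mulVec_tripletSinglet (g : Matrix (Fin 2) (Fin 2) ℂ) (hg : g * gᴴ = 1) :
    vAction g *ᵥ tripletSinglet = tripletSinglet := by
  ext ⟨⟨a, b⟩, c, d⟩
  rw [tripletSinglet_apply ((a, b), c, d), ← hg]
  simp [vAction, mulVec, dotProduct, tripletSinglet_apply, Fintype.sum_prod_type,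
    Fin.sum_univ_two, mul_apply, one_apply]
  ring

theorem kronecker_conj_conjTranspose (g : Matrix (Fin 2) (Fin 2) ℂ) :
    (g ⊗ₖ g.map star)ᴴ = gᴴ ⊗ₖ gᴴ.map star := by
  rw [conjTranspose_kronecker]
  congr 1

theorem isVInvariant_testV : IsVInvariant testV := by
  intro g hg
  have h1 : g * gᴴ = 1 := (mem_unitaryGroup_iff).1 (mem_specialUnitaryGroup_iff.1 hg).1
  have h2 : gᴴ * g = 1 := (mem_unitaryGroup_iff').1 (mem_specialUnitaryGroup_iff.1 hg).1
  have h3 : gᴴ * gᴴᴴ = 1 := by rwa [conjTranspose_conjTranspose]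
  refine conj_testV ?_ ?_ ?_
  · have h4 : (g.map star)ᴴ * g.map star = 1 := by
      have := congrArg transpose h2
      rw [transpose_mul, transpose_one] at this
      have h5 : (g.map star)ᴴ = gᵀ := by ext i j; simp
      rw [h5]
      exact this
    rw [conjTranspose_kronecker, ← mul_kronecker_mul, h2, h4, one_kronecker_one]
  · rw [kronecker_conj_conjTranspose]
    exact conj_kronecker_mulVec_phi_zero _ h3
  · rw [conjTranspose_kronecker, kronecker_conj_conjTranspose]
    exact vAction_mulVec_tripletSinglet _ h3

theorem abTransposition_eq :
    abTransposition = ((2 : ℂ) • phiUnit 0 0 - 1) ⊗ₖ ((2 : ℂ) • phiUnit 0 0 - 1) := by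
  -- the AB-transposition of one sample
  have h : (2 : ℂ) • phiUnit 0 0 - 1 = Matrix.of fun r c : Sample =>
      if r = (1 - c.2, 1 - c.1) then (-1 : ℂ) ^ ((c.1 : ℕ) + (c.2 : ℕ)) else 0 := by
    have h := inv_sqrt_two_mul_self
    ext ⟨a, b⟩ ⟨c, d⟩
    fin_cases a <;> fin_cases b <;> fin_cases c <;> fin_cases d <;>
      simp [phiUnit, vecMulVec_apply, phi, one_apply, h]
  rw [h]
  ext ⟨r, r'⟩ ⟨c, c'⟩
  simp only [abTransposition, of_apply, kroneckerMap_apply, Prod.mk.injEq]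
  by_cases h1 : r = (1 - c.2, 1 - c.1) <;> by_cases h2 : r' = (1 - c'.2, 1 - c'.1) <;>
    simp [h1, h2, pow_add, mul_assoc]

theorem phiUnit_conjTranspose (i j : Fin 4) : (phiUnit i j)ᴴ = phiUnit j i := by
  rw [phiUnit, conjTranspose_vecMulVec, star_star, phiUnit]

theorem isABInvariant_testV : IsABInvariant testV := by
  have hh : ((2 : ℂ) • phiUnit 0 0 - 1)ᴴ = (2 : ℂ) • phiUnit 0 0 - 1 := by
    simp [conjTranspose_sub, conjTranspose_smul, phiUnit_conjTranspose]
  -- the reflection fixes `φ⁰` and changes the sign of `φ¹, φ², φ³`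
  have hφ : ∀ i, ((2 : ℂ) • phiUnit 0 0 - 1) *ᵥ phi i =
      if i = 0 then phi 0 else -phi i := by
    intro i
    rw [sub_mulVec, smul_mulVec, phiUnit, vecMulVec_mulVec, star_phi_dotProduct_phi, one_mulVec]
    rcases eq_or_ne i 0 with rfl | hi
    · simp [two_smul]
    · simp [hi, hi.symm]
  have he : ∀ i, i ≠ 0 → (((2 : ℂ) • phiUnit 0 0 - 1) ⊗ₖ ((2 : ℂ) • phiUnit 0 0 - 1)) *ᵥ
      eVec i i = eVec i i := by
    intro i hi
    have h := hφ i
    rw [if_neg hi] at h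
    ext q
    have h1 := congrFun h q.1
    have h2 := congrFun h q.2
    simp only [mulVec, dotProduct, Pi.neg_apply] at h1 h2
    simp only [mulVec, dotProduct, kroneckerMap_apply, eVec, Fintype.sum_prod_type (α₁ := Sample)]
    have : phi i q.1 * phi i q.2 = (-phi i q.1) * (-phi i q.2) := by ring
    rw [this, ← h1, ← h2, Finset.sum_mul_sum]
    exact Finset.sum_congr rfl fun _ _ => Finset.sum_congr rfl fun _ _ => by ring
  rw [IsABInvariant, abTransposition_eq]
  refine conj_testV ?_ ?_ ?_
  · rw [hh]
    simp only [sub_mul, mul_sub, smul_mul_smul_comm, phiUnit_mul, mul_one, one_mul, if_true]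
    module
  · rw [hh, hφ, if_pos rfl]
  · rw [conjTranspose_kronecker, hh, tripletSinglet, mulVec_add, mulVec_add, he 1 (by decide),
      he 2 (by decide), he 3 (by decide)]

theorem isSampleSymmetric_testV : IsSampleSymmetric testV := by
  have h : ∀ A B : Matrix Sample Sample ℂ,
      (A ⊗ₖ B).submatrix Prod.swap Prod.swap = B ⊗ₖ A := fun A B => by
    ext r c
    simp [kroneckerMap_apply, mul_comm]
  rw [IsSampleSymmetric, testV_eq_phiUnit]
  simp only [submatrix_add, submatrix_sub, submatrix_smul, Pi.add_apply, Pi.sub_apply,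
    Pi.smul_apply, h]
  module

/-! ### Realization of the test by a finite random choice of axes -/

/-- The vector `(φ⁰ - √-1 (x₀ φ¹ + x₁ φ² + x₂ φ³)) / √2`; it is the product vector onto which
`twin x` projects. -/
def twinVec (x : Fin 3 → ℝ) : Sample → ℂ :=
  ((Real.sqrt 2 : ℝ) : ℂ)⁻¹ • (phi 0 - Complex.I •
    ((x 0 : ℂ) • phi 1 + (x 1 : ℂ) • phi 2 + (x 2 : ℂ) • phi 3))

theorem twinVec_apply (x : Fin 3 → ℝ) (a b : Fin 2) : twinVec x (a, b) = qubit x a b := by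
  have h := inv_sqrt_two_mul_self
  fin_cases a <;> fin_cases b <;> simp [twinVec, qubit, phi] <;> ring_nf <;>
    simp [pow_two, Complex.I_mul_I, h] <;> ring

/-- The minors of a rank-one projection vanish. -/
theorem qubit_apply_mul_apply {x : Fin 3 → ℝ} (hx : IsUnitVec x) (i j k l : Fin 2) :
    qubit x i j * qubit x k l = qubit x i l * qubit x k j := by
  have h := hx.complex
  fin_cases i <;> fin_cases j <;> fin_cases k <;> fin_cases l <;>
    simp [qubit] <;> ring_nf <;> (try simp only [Complex.I_sq]) <;>
    first
      | (ring_nf; done)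
      | linear_combination (1 / 4 : ℂ) * h
      | linear_combination (-1 / 4 : ℂ) * h

theorem twin_eq_vecMulVec {x : Fin 3 → ℝ} (hx : IsUnitVec x) :
    twin x = vecMulVec (twinVec x) (star (twinVec x)) := by
  ext ⟨a, b⟩ ⟨c, d⟩
  have h := (qubit_isHermitian x).apply d c
  simp only [twin, kroneckerMap_apply, transpose_apply, vecMulVec_apply, Pi.star_apply,
    twinVec_apply, h, qubit_apply_mul_apply hx a c d b]

/-- The coefficients of the product vector of `x` in the basis `φ⁰, …, φ³`, up to `1 / √2`. -/
def twinCoeff (x : Fin 3 → ℝ) : Fin 4 → ℂ :=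
  ![1, -Complex.I * x 0, -Complex.I * x 1, -Complex.I * x 2]

theorem twin_eq_sum {x : Fin 3 → ℝ} (hx : IsUnitVec x) :
    twin x = (1 / 2 : ℂ) • ∑ i, ∑ j, (twinCoeff x i * star (twinCoeff x j)) • phiUnit i j := by
  have h : twinVec x = ((Real.sqrt 2 : ℝ) : ℂ)⁻¹ • ∑ i, twinCoeff x i • phi i := by
    simp only [twinVec, twinCoeff, Fin.sum_univ_four]
    simp
    module
  rw [twin_eq_vecMulVec hx, h, star_smul, smul_vecMulVec, vecMulVec_smul, smul_smul, star_sum]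
  have h2 : star ((Real.sqrt 2 : ℝ) : ℂ)⁻¹ = ((Real.sqrt 2 : ℝ) : ℂ)⁻¹ := by simp
  rw [h2, inv_sqrt_two_mul_self]
  congr 1
  simp only [Fin.sum_univ_four, add_vecMulVec, vecMulVec_add, star_smul, smul_vecMulVec,
    vecMulVec_smul, phiUnit, mul_smul, smul_add]
  module

theorem agree_eq {x : Fin 3 → ℝ} (hx : IsUnitVec x) :
    agree x = phiUnit 0 0 +
      ((x 0 : ℂ) ^ 2 • phiUnit 1 1 + (x 1 : ℂ) ^ 2 • phiUnit 2 2 + (x 2 : ℂ) ^ 2 • phiUnit 3 3) +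
      ((x 0 * x 1 : ℂ) • (phiUnit 1 2 + phiUnit 2 1) +
        (x 1 * x 2 : ℂ) • (phiUnit 2 3 + phiUnit 3 2) +
        (x 2 * x 0 : ℂ) • (phiUnit 3 1 + phiUnit 1 3)) := by
  -- the terms of odd degree in `x` cancel
  have hc : ∀ i j, twinCoeff x i * star (twinCoeff x j) +
      twinCoeff (-x) i * star (twinCoeff (-x) j) =
      2 * !![1, 0, 0, 0; 0, (x 0 : ℂ) ^ 2, x 0 * x 1, x 2 * x 0;
        0, x 0 * x 1, (x 1 : ℂ) ^ 2, x 1 * x 2; 0, x 2 * x 0, x 1 * x 2, (x 2 : ℂ) ^ 2] i j := by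
    intro i j
    fin_cases i <;> fin_cases j <;> simp [twinCoeff] <;> ring_nf <;>
      simp only [Complex.I_sq] <;> ring
  rw [agree, twin_eq_sum hx, twin_eq_sum hx.neg, ← smul_add, ← Finset.sum_add_distrib]
  simp only [← Finset.sum_add_distrib, ← add_smul, hc]
  simp [Fin.sum_univ_four]
  module

/-- Pairs of orthonormal axes: for each `k`, the pairs of coordinate axes and of diagonals in the
coordinate plane orthogonal to the axis `k`, in both orders. -/
def frame : Fin 4 × Fin 3 → (Fin 3 → ℝ) × (Fin 3 → ℝ) := fun f =>
  let e : Fin 3 → ℝ := Pi.single (f.2 + 1) 1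
  let e' : Fin 3 → ℝ := Pi.single (f.2 + 2) 1
  let s : ℝ := (Real.sqrt 2)⁻¹
  ![(e, e'), (e', e), (s • (e + e'), s • (e - e')), (s • (e - e'), s • (e + e'))] f.1

/-- The probabilities of the pairs of axes. -/
def frameWeight (f : Fin 4 × Fin 3) : ℝ := ![1 / 10, 1 / 10, 1 / 15, 1 / 15] f.1

theorem isUnitVec_frame (f : Fin 4 × Fin 3) : IsUnitVec (frame f).1 ∧ IsUnitVec (frame f).2 := by
  obtain ⟨t, k⟩ := f
  fin_cases t <;> fin_cases k <;> constructor <;>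
    simp [IsUnitVec, frame, Fin.ext_iff] <;> norm_num

theorem testV_eq_sum_frame :
    testV = ∑ f, (frameWeight f : ℂ) • (agree (frame f).1 ⊗ₖ agree (frame f).2) := by
  have h2 := inv_sqrt_two_mul_self
  have h3 : (((Real.sqrt 2 : ℝ) : ℂ) ^ 2)⁻¹ = 1 / 2 := by rw [sq, mul_inv, h2]
  have h : ∀ f, agree (frame f).1 ⊗ₖ agree (frame f).2 = _ ⊗ₖ _ := fun f => by
    rw [agree_eq (isUnitVec_frame f).1, agree_eq (isUnitVec_frame f).2]
  simp only [h, Fintype.sum_prod_type, Fin.sum_univ_four, Fin.sum_univ_three]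
  simp [frame, frameWeight, Fin.ext_iff]
  simp only [h2, h3, ← neg_smul, testV_eq_phiUnit, kronecker_add, add_kronecker, smul_kronecker,
    kronecker_smul]
  module

theorem isJointlyLocal_testV : IsJointlyLocal testV := by
  rw [testV_eq_sum_frame]
  refine IsLOCC.mixture (loc := qubitParties) 0 (fun c => ?_) _ ?_ ?_ _ fun f =>
    isJointlyLocal_agree (isUnitVec_frame f).1 (isUnitVec_frame f).2
  · exact ⟨c • 1, by simp only [smul_kronecker, one_kronecker_one]⟩
  · rintro ⟨t, k⟩
    fin_cases t <;> norm_num [frameWeight]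
  · simp [frameWeight, Fintype.sum_prod_type, Fin.sum_univ_four]
    norm_num

theorem isTermwiseABCovariant_testV : IsTermwiseABCovariant testV := by
  rw [testV_eq_sum_frame]
  refine .sum _ fun f _ => .smul (isTermwiseABCovariant_agree (isUnitVec_frame f).1
    (isUnitVec_frame f).2) ?_
  obtain ⟨t, k⟩ := f
  fin_cases t <;> norm_num [frameWeight]

/-! ### Error probabilities of the test -/

theorem xEl_conj {σ : Matrix Sample Sample ℂ} (hσ : σ.IsHermitian) (i j : Fin 4) :
    star (xEl σ i j) = xEl σ j i := by
  rw [xEl, xEl, ← star_dotProduct_star, star_mulVec, hσ.eq, star_star, ← dotProduct_mulVec]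

theorem sum_xEl (σ : Matrix Sample Sample ℂ) :
    xEl σ 0 0 + xEl σ 1 1 + xEl σ 2 2 + xEl σ 3 3 = σ.trace := by
  simp only [← trace_mul_phiUnit, ← trace_add, ← mul_add, sum_phiUnit, mul_one]

/-- The type 2 error in terms of the real parts of the matrix elements. -/
theorem typeTwoError_testV_eq {σ : Matrix Sample Sample ℂ} (hσ : σ.IsHermitian) :
    typeTwoError testV (σ ⊗ₖ σ) = (xEl σ 0 0).re ^ 2 +
      2 / 3 * (xEl σ 0 0).re * ((xEl σ 1 1).re + (xEl σ 2 2).re + (xEl σ 3 3).re) +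
      2 / 15 * ((xEl σ 1 1).re + (xEl σ 2 2).re + (xEl σ 3 3).re) ^ 2 -
      1 / 15 * ((xEl σ 1 1).re ^ 2 + (xEl σ 2 2).re ^ 2 + (xEl σ 3 3).re ^ 2 +
        2 * ((xEl σ 1 2).re ^ 2 + (xEl σ 2 3).re ^ 2 + (xEl σ 3 1).re ^ 2)) := by
  have hd : ∀ i, (xEl σ i i).im = 0 := fun i => by
    have := congrArg Complex.im (xEl_conj hσ i i)
    simp at this; linarith
  rw [typeTwoError, testV_eq_phiUnit]
  simp only [kronecker_add, add_kronecker, mul_add, mul_sub, mul_smul_comm, trace_add, trace_sub,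
    trace_smul, ← mul_kronecker_mul, trace_kronecker, trace_mul_phiUnit, smul_add]
  rw [← xEl_conj hσ 1 2, ← xEl_conj hσ 2 3, ← xEl_conj hσ 3 1]
  simp [hd]
  ring

theorem typeTwoError_testV {σ : Matrix Sample Sample ℂ} (hσ : IsDensity σ) :
    typeTwoError testV (σ ⊗ₖ σ) =
      vVec σ ⬝ᵥ (zMat *ᵥ vVec σ) -
        2 / 15 * ((xEl σ 1 2).re ^ 2 + (xEl σ 2 3).re ^ 2 + (xEl σ 3 1).re ^ 2) := by
  have ht : (xEl σ 0 0).re = 1 - (xEl σ 1 1).re - (xEl σ 2 2).re - (xEl σ 3 3).re := by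
    have := congrArg Complex.re ((sum_xEl σ).trans hσ.2)
    simp at this; linarith
  rw [typeTwoError_testV_eq hσ.1.isHermitian, ht]
  simp [vVec, zMat, mulVec, dotProduct, Fin.sum_univ_three]
  ring

theorem isLevel_testV : IsLevel nullStates 0 testV := by
  rintro ρ rfl
  have h : ketbra (phi 0) ⊗ₖ ketbra (phi 0) = phiUnit 0 0 ⊗ₖ phiUnit 0 0 := rfl
  have h2 : phiUnit 0 0 ⊗ₖ phiUnit 0 0 * (1 - testV) = 0 := by
    rw [testV_eq_phiUnit]
    simp only [kronecker_add, add_kronecker, mul_add, mul_sub, mul_smul_comm, mul_one,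
      ← mul_kronecker_mul, phiUnit_mul]
    simp
  rw [typeOneError, h, h2]
  simp

/-- A test of level zero fixes the vector `φ⁰ ⊗ φ⁰`. -/
theorem mulVec_eVec_zero_zero {T : Matrix Pair Pair ℂ} (hT : IsTest T)
    (hL : IsLevel nullStates 0 T) : T *ᵥ eVec 0 0 = eVec 0 0 := by
  have h := hL _ rfl
  have h1 : ketbra (phi 0) ⊗ₖ ketbra (phi 0) = vecMulVec (eVec 0 0) (star (eVec 0 0)) :=
    (vecMulVec_eVec 0 0 0 0).symm
  rw [typeOneError, h1, trace_mul_comm, mul_vecMulVec, trace_vecMulVec, dotProduct_comm] at h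
  have h2 := hT.2.dotProduct_mulVec_nonneg (eVec 0 0)
  rw [Complex.le_def] at h2
  have h3 : star (eVec 0 0) ⬝ᵥ ((1 - T) *ᵥ eVec 0 0) = 0 :=
    Complex.ext (le_antisymm h h2.1) h2.2.symm
  have h4 := (hT.2.dotProduct_mulVec_zero_iff _).1 h3
  rw [sub_mulVec, one_mulVec, sub_eq_zero] at h4
  exact h4.symm

/-! ### Ensembles of Bloch vectors -/

theorem trace_twin_mul_phiUnit {x : Fin 3 → ℝ} (hx : IsUnitVec x) (i j : Fin 4) :
    (twin x * phiUnit i j).trace = 1 / 2 * (twinCoeff x j * star (twinCoeff x i)) := by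
  rw [twin_eq_sum hx]
  simp [Finset.sum_mul, trace_sum, phiUnit_mul, trace_phiUnit]

/-- The quadratic functions on the Bloch sphere that are expectation values of operators on one
sample. -/
def IsObservable (f : (Fin 3 → ℝ) → ℝ) : Prop :=
  ∃ X : Matrix Sample Sample ℂ, ∀ x, IsUnitVec x → (X * twin x).trace = f x

/-- The expectation value of a Hermitian `σ` in the product state of the Bloch vector `x`. -/
theorem trace_mul_twin {σ : Matrix Sample Sample ℂ} (hσ : σ.IsHermitian) {x : Fin 3 → ℝ}
    (hx : IsUnitVec x) : (σ * twin x).trace =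
      (1 / 2 * ((xEl σ 0 0).re + 2 * ((xEl σ 0 1).im * x 0 + (xEl σ 0 2).im * x 1 +
        (xEl σ 0 3).im * x 2) + ((xEl σ 1 1).re * x 0 ^ 2 + (xEl σ 2 2).re * x 1 ^ 2 +
        (xEl σ 3 3).re * x 2 ^ 2) + 2 * ((xEl σ 2 3).re * (x 1 * x 2) +
        (xEl σ 3 1).re * (x 2 * x 0) + (xEl σ 1 2).re * (x 0 * x 1))) : ℝ) := by
  have hd : ∀ i, (xEl σ i i).im = 0 := fun i => by
    have := congrArg Complex.im (xEl_conj hσ i i)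
    simp at this; linarith
  rw [twin_eq_sum hx]
  simp only [Fin.sum_univ_four, mul_add, mul_smul_comm, trace_add, trace_smul,
    trace_mul_phiUnit]
  rw [← xEl_conj hσ 1 2, ← xEl_conj hσ 2 3, ← xEl_conj hσ 3 1, ← xEl_conj hσ 0 1,
    ← xEl_conj hσ 0 2, ← xEl_conj hσ 0 3]
  apply Complex.ext <;> simp [twinCoeff, hd, sq] <;> ring

theorem trace_kronecker_mul_twin (A B : Matrix (Fin 2) (Fin 2) ℂ) (x : Fin 3 → ℝ) :
    ((A ⊗ₖ Bᵀ) * twin x).trace = (A * qubit x).trace * (B * qubit x).trace := by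
  rw [twin, ← mul_kronecker_mul, trace_kronecker, ← transpose_mul, trace_transpose,
    trace_mul_comm (qubit x) B]

/-- The Pauli operators that read off the coordinates of the Bloch vector. -/
def blochPauli : Fin 3 → Matrix (Fin 2) (Fin 2) ℂ :=
  ![!![0, 1; 1, 0], !![0, Complex.I; -Complex.I, 0], !![1, 0; 0, -1]]

theorem trace_blochPauli_mul_qubit (i : Fin 3) (x : Fin 3 → ℝ) :
    (blochPauli i * qubit x).trace = x i := by
  fin_cases i <;> simp [blochPauli, qubit, trace_fin_two] <;> ring_nf
  simp [Complex.I_sq]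

theorem trace_qubit (x : Fin 3 → ℝ) : (qubit x).trace = 1 := by
  simp [qubit, trace_fin_two]; ring

theorem isObservable_one : IsObservable fun _ => 1 :=
  ⟨1 ⊗ₖ 1ᵀ, fun x _ => by rw [trace_kronecker_mul_twin]; simp [trace_qubit]⟩

theorem isObservable_coord (i : Fin 3) : IsObservable fun x => x i :=
  ⟨blochPauli i ⊗ₖ 1ᵀ, fun x _ => by
    rw [trace_kronecker_mul_twin, trace_blochPauli_mul_qubit]; simp [trace_qubit]⟩

theorem isObservable_coord_mul (i j : Fin 3) : IsObservable fun x => x i * x j :=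
  ⟨blochPauli i ⊗ₖ (blochPauli j)ᵀ, fun x _ => by
    rw [trace_kronecker_mul_twin, trace_blochPauli_mul_qubit, trace_blochPauli_mul_qubit]; simp⟩

/-- The sum of the values of `F` at the pairs `(x k, y k)`, with the weights `p k`. -/
def ensemble {m : ℕ} (p : Fin m → ℝ) (x y : Fin m → Fin 3 → ℝ)
    (F : (Fin 3 → ℝ) → (Fin 3 → ℝ) → ℝ) : ℝ := ∑ k, p k * F (x k) (y k)

/-- The action of a qubit unitary on Bloch vectors preserves products of observables in an
ensemble of a V-invariant operator. -/
theorem IsVInvariant.ensemble_comp {m : ℕ} {p : Fin m → ℝ} {x y : Fin m → Fin 3 → ℝ}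
    (hx : ∀ k, IsUnitVec (x k)) (hy : ∀ k, IsUnitVec (y k))
    (hV : IsVInvariant (∑ k, (p k : ℂ) • (twin (x k) ⊗ₖ twin (y k))))
    {g : Matrix (Fin 2) (Fin 2) ℂ} (hg : g ∈ specialUnitaryGroup (Fin 2) ℂ)
    {O : (Fin 3 → ℝ) → Fin 3 → ℝ} (hO : ∀ z, gᴴ * qubit z * g = qubit (O z))
    (hOu : ∀ z, IsUnitVec z → IsUnitVec (O z))
    {f f' : (Fin 3 → ℝ) → ℝ} (hf : IsObservable f) (hf' : IsObservable f') :
    ensemble p x y (fun a b => f (O a) * f' (O b)) = ensemble p x y (fun a b => f a * f' b) := by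
  obtain ⟨X, hX⟩ := hf
  obtain ⟨X', hX'⟩ := hf'
  have htw : ∀ z, (g ⊗ₖ g.map star)ᴴ * twin z * (g ⊗ₖ g.map star) = twin (O z) := by
    intro z
    have h : (g.map star)ᴴ * (qubit z)ᵀ * g.map star = (gᴴ * qubit z * g)ᵀ := by
      rw [transpose_mul, transpose_mul, ← mul_assoc]
      have h5 : (g.map star)ᴴ = gᵀ := by ext i j; simp
      rw [h5]
      rfl
    rw [twin, twin, conjTranspose_kronecker, ← mul_kronecker_mul, ← mul_kronecker_mul, h, hO]
  have h := congrArg (fun S => ((X ⊗ₖ X') * S).trace) (hV g hg)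
  simp only [vAction, Finset.mul_sum, Finset.sum_mul, mul_smul_comm, smul_mul_assoc,
    conjTranspose_kronecker (g ⊗ₖ g.map star), ← mul_kronecker_mul, htw, trace_sum, trace_smul,
    trace_kronecker, hX _ (hx _), hX' _ (hy _), hX _ (hOu _ (hx _)), hX' _ (hOu _ (hy _)),
    smul_eq_mul] at h
  simp only [ensemble]
  exact_mod_cast h

/-- The rotation of the Bloch sphere given by the unit quaternion `(a, b, c, d)`, in the
coordinates of `qubit`. -/
def rotate (a b c d : ℝ) (z : Fin 3 → ℝ) : Fin 3 → ℝ :=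
  ![(a ^ 2 - b ^ 2 - c ^ 2 + d ^ 2) * z 0 - 2 * (c * d - a * b) * z 1 + 2 * (b * d + a * c) * z 2,
    -2 * (c * d + a * b) * z 0 + (a ^ 2 - b ^ 2 + c ^ 2 - d ^ 2) * z 1 - 2 * (b * c - a * d) * z 2,
    2 * (b * d - a * c) * z 0 - 2 * (b * c + a * d) * z 1 + (a ^ 2 + b ^ 2 - c ^ 2 - d ^ 2) * z 2]

/-- The element of `SU(2)` given by the unit quaternion `(a, b, c, d)`. -/
def quaternionMatrix (a b c d : ℝ) : Matrix (Fin 2) (Fin 2) ℂ :=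
  !![a + b * Complex.I, c + d * Complex.I; -c + d * Complex.I, a - b * Complex.I]

theorem quaternionMatrix_mem {a b c d : ℝ} (h : a ^ 2 + b ^ 2 + c ^ 2 + d ^ 2 = 1) :
    quaternionMatrix a b c d ∈ specialUnitaryGroup (Fin 2) ℂ := by
  refine mem_specialUnitaryGroup_iff.2 ⟨mem_unitaryGroup_iff.2 ?_, ?_⟩
  · ext i j
    fin_cases i <;> fin_cases j <;> apply Complex.ext <;>
      simp [quaternionMatrix, star_eq_conjTranspose, mul_apply, Fin.sum_univ_two] <;>
      linarith [h]
  · rw [quaternionMatrix, det_fin_two_of]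
    apply Complex.ext <;> simp <;> linarith

theorem conj_quaternionMatrix_qubit {a b c d : ℝ} (h : a ^ 2 + b ^ 2 + c ^ 2 + d ^ 2 = 1)
    (z : Fin 3 → ℝ) :
    (quaternionMatrix a b c d)ᴴ * qubit z * quaternionMatrix a b c d =
      qubit (rotate a b c d z) := by
  have e : ∀ w : ℂ, w / 2 = ((1 / 2 : ℝ) : ℂ) * w := fun w => by push_cast; ring
  ext i j
  fin_cases i <;> fin_cases j <;> apply Complex.ext <;>
    simp [quaternionMatrix, qubit, rotate, mul_apply, Fin.sum_univ_two, e, sq] <;>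
    ring_nf at h ⊢ <;>
    first
      | done
      | linear_combination (1 / 2 : ℝ) * h

theorem isUnitVec_rotate {a b c d : ℝ} (h : a ^ 2 + b ^ 2 + c ^ 2 + d ^ 2 = 1)
    {z : Fin 3 → ℝ} (hz : IsUnitVec z) : IsUnitVec (rotate a b c d z) := by
  simp only [IsUnitVec, rotate, cons_val] at hz ⊢
  linear_combination (a ^ 2 + b ^ 2 + c ^ 2 + d ^ 2) ^ 2 * hz +
    (a ^ 2 + b ^ 2 + c ^ 2 + d ^ 2 + 1) * h

/-! ### Moments of an invariant ensemble -/

/-- The map `O` of Bloch vectors preserves the expectation values of products of observables. -/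
def Preserves {m : ℕ} (p : Fin m → ℝ) (x y : Fin m → Fin 3 → ℝ)
    (O : (Fin 3 → ℝ) → Fin 3 → ℝ) : Prop :=
  ∀ f f' : (Fin 3 → ℝ) → ℝ, IsObservable f → IsObservable f' →
    ensemble p x y (fun a b => f (O a) * f' (O b)) = ensemble p x y fun a b => f a * f' b

section Moments

variable {m : ℕ} {p : Fin m → ℝ} {x y : Fin m → Fin 3 → ℝ}

theorem IsVInvariant.preserves_rotate
    (hx : ∀ k, IsUnitVec (x k)) (hy : ∀ k, IsUnitVec (y k))
    (hV : IsVInvariant (∑ k, (p k : ℂ) • (twin (x k) ⊗ₖ twin (y k))))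
    {a b c d : ℝ} (h : a ^ 2 + b ^ 2 + c ^ 2 + d ^ 2 = 1) :
    Preserves p x y (rotate a b c d) := fun _ _ hf hf' =>
  hV.ensemble_comp hx hy (quaternionMatrix_mem h) (conj_quaternionMatrix_qubit h)
    (fun _ => isUnitVec_rotate h) hf hf'

theorem Preserves.eq_of_comp {O : (Fin 3 → ℝ) → Fin 3 → ℝ} (hO : Preserves p x y O)
    {f f' : (Fin 3 → ℝ) → ℝ} (hf : IsObservable f) (hf' : IsObservable f')
    {F : (Fin 3 → ℝ) → (Fin 3 → ℝ) → ℝ} (h : ∀ a b, f (O a) * f' (O b) = F a b) :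
    ensemble p x y F = ensemble p x y fun a b => f a * f' b := by
  rw [← hO f f' hf hf']
  simp only [h]

theorem Preserves.eq_zero_of_odd {O : (Fin 3 → ℝ) → Fin 3 → ℝ} (hO : Preserves p x y O)
    {f f' : (Fin 3 → ℝ) → ℝ} (hf : IsObservable f) (hf' : IsObservable f')
    (h : ∀ a b, f (O a) * f' (O b) = -(f a * f' b)) :
    ensemble p x y (fun a b => f a * f' b) = 0 := by
  have h1 := hO.eq_of_comp hf hf' h
  have h2 : ensemble p x y (fun a b => -(f a * f' b)) =
      -ensemble p x y (fun a b => f a * f' b) := by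
    simp only [ensemble, mul_neg, Finset.sum_neg_distrib]
  linarith

/-- The ensemble is invariant under the rotations of the Bloch sphere, as far as products of
observables are concerned. -/
def IsRotationInvariant {m : ℕ} (p : Fin m → ℝ) (x y : Fin m → Fin 3 → ℝ) : Prop :=
  ∀ a b c d : ℝ, a ^ 2 + b ^ 2 + c ^ 2 + d ^ 2 = 1 → Preserves p x y (rotate a b c d)

theorem IsRotationInvariant.halfTurn_zero (hR : IsRotationInvariant p x y) :
    Preserves p x y fun a => ![a 0, -a 1, -a 2] := by
  convert hR 0 0 0 1 (by norm_num) using 2 with a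
  ext i; fin_cases i <;> simp [rotate]

theorem IsRotationInvariant.halfTurn_one (hR : IsRotationInvariant p x y) :
    Preserves p x y fun a => ![-a 0, a 1, -a 2] := by
  convert hR 0 0 1 0 (by norm_num) using 2 with a
  ext i; fin_cases i <;> simp [rotate]

theorem IsRotationInvariant.halfTurn_two (hR : IsRotationInvariant p x y) :
    Preserves p x y fun a => ![-a 0, -a 1, a 2] := by
  convert hR 0 1 0 0 (by norm_num) using 2 with a
  ext i; fin_cases i <;> simp [rotate]

theorem IsRotationInvariant.cyclic (hR : IsRotationInvariant p x y) :
    Preserves p x y fun a => ![a 2, -a 0, -a 1] := by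
  convert hR (1 / 2) (1 / 2) (1 / 2) (1 / 2) (by norm_num) using 2 with a
  ext i; fin_cases i <;> simp [rotate] <;> ring

/-- The rotation about the third axis with cosine `-7 / 25` and sine `24 / 25`; unlike the other
rotations used, it is no symmetry of the cube. -/
theorem IsRotationInvariant.oblique (hR : IsRotationInvariant p x y) :
    Preserves p x y fun a => ![(-7 * a 0 + 24 * a 1) / 25, (-24 * a 0 - 7 * a 1) / 25, a 2] := by
  convert hR (3 / 5) (4 / 5) 0 0 (by norm_num) using 2 with a
  ext i; fin_cases i <;> simp [rotate] <;> ring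

/-- The moments of degree one in `a` and two in `b` that are even under the half-turns vanish. -/
theorem IsRotationInvariant.moment_one_two (hR : IsRotationInvariant p x y) :
    ensemble p x y (fun a b => a 2 * (b 0 * b 1)) = 0 ∧
    ensemble p x y (fun a b => a 0 * (b 1 * b 2)) = 0 ∧
    ensemble p x y (fun a b => a 1 * (b 2 * b 0)) = 0 := by
  have o := isObservable_coord
  have oo := isObservable_coord_mul
  have z0 := hR.halfTurn_zero.eq_zero_of_odd (o 2) (oo 0 0) (by intros; simp)
  have z1 := hR.halfTurn_zero.eq_zero_of_odd (o 2) (oo 1 1) (by intros; simp)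
  have t := hR.oblique _ _ (o 2) (oo 0 1)
  have t0 := hR.cyclic.eq_of_comp (o 0) (oo 1 2) (F := fun a b => a 2 * (b 0 * b 1))
    (by intros; simp)
  have t1 := hR.cyclic.eq_of_comp (o 1) (oo 2 0) (F := fun a b => a 0 * (b 1 * b 2))
    (by intros; simp)
  have e : ensemble p x y (fun a b => a 2 * (((-7 * b 0 + 24 * b 1) / 25) *
      ((-24 * b 0 - 7 * b 1) / 25))) =
      168 / 625 * ensemble p x y (fun a b => a 2 * (b 0 * b 0)) -
      168 / 625 * ensemble p x y (fun a b => a 2 * (b 1 * b 1)) -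
      527 / 625 * ensemble p x y (fun a b => a 2 * (b 0 * b 1)) := by
    simp only [ensemble, Finset.mul_sum, ← Finset.sum_sub_distrib]
    exact Finset.sum_congr rfl fun k _ => by ring
  simp only [cons_val] at t
  refine ⟨?_, ?_, ?_⟩ <;> linarith

/-- The moments of degree two in `a` and one in `b` that are even under the half-turns vanish. -/
theorem IsRotationInvariant.moment_two_one (hR : IsRotationInvariant p x y) :
    ensemble p x y (fun a b => a 0 * a 1 * b 2) = 0 ∧
    ensemble p x y (fun a b => a 1 * a 2 * b 0) = 0 ∧
    ensemble p x y (fun a b => a 2 * a 0 * b 1) = 0 := by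
  have o := isObservable_coord
  have oo := isObservable_coord_mul
  have z0 := hR.halfTurn_zero.eq_zero_of_odd (oo 0 0) (o 2) (by intros; simp)
  have z1 := hR.halfTurn_zero.eq_zero_of_odd (oo 1 1) (o 2) (by intros; simp)
  have t := hR.oblique _ _ (oo 0 1) (o 2)
  have t0 := hR.cyclic.eq_of_comp (oo 1 2) (o 0) (F := fun a b => a 0 * a 1 * b 2)
    (by intros; simp)
  have t1 := hR.cyclic.eq_of_comp (oo 2 0) (o 1) (F := fun a b => a 1 * a 2 * b 0)
    (by intros; simp)
  have e : ensemble p x y (fun a b => ((-7 * a 0 + 24 * a 1) / 25) *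
      ((-24 * a 0 - 7 * a 1) / 25) * b 2) =
      168 / 625 * ensemble p x y (fun a b => a 0 * a 0 * b 2) -
      168 / 625 * ensemble p x y (fun a b => a 1 * a 1 * b 2) -
      527 / 625 * ensemble p x y (fun a b => a 0 * a 1 * b 2) := by
    simp only [ensemble, Finset.mul_sum, ← Finset.sum_sub_distrib]
    exact Finset.sum_congr rfl fun k _ => by ring
  simp only [cons_val] at t
  refine ⟨?_, ?_, ?_⟩ <;> linarith

/-- The relation between the fourth moments that the symmetries of the cube do not give. -/
theorem IsRotationInvariant.moment_two_two (hR : IsRotationInvariant p x y) :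
    2 * ensemble p x y (fun a b => a 0 * a 0 * (b 0 * b 0)) =
      ensemble p x y (fun a b => a 0 * a 0 * (b 1 * b 1)) +
      ensemble p x y (fun a b => a 1 * a 1 * (b 0 * b 0)) +
      4 * ensemble p x y (fun a b => a 0 * a 1 * (b 0 * b 1)) := by
  have oo := isObservable_coord_mul
  have s := hR.cyclic.eq_of_comp (oo 1 1) (oo 1 1) (F := fun a b => a 0 * a 0 * (b 0 * b 0))
    (by intros; simp)
  have v0 := hR.halfTurn_zero.eq_zero_of_odd (oo 0 0) (oo 0 1) (by intros; simp)
  have v1 := hR.halfTurn_zero.eq_zero_of_odd (oo 1 1) (oo 0 1) (by intros; simp)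
  have v2 := hR.halfTurn_zero.eq_zero_of_odd (oo 0 1) (oo 0 0) (by intros; simp)
  have v3 := hR.halfTurn_zero.eq_zero_of_odd (oo 0 1) (oo 1 1) (by intros; simp)
  have g := hR.oblique _ _ (oo 0 0) (oo 0 0)
  have e : ensemble p x y (fun a b => ((-7 * a 0 + 24 * a 1) / 25) * ((-7 * a 0 + 24 * a 1) / 25) *
      (((-7 * b 0 + 24 * b 1) / 25) * ((-7 * b 0 + 24 * b 1) / 25))) =
      2401 / 390625 * ensemble p x y (fun a b => a 0 * a 0 * (b 0 * b 0)) +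
      331776 / 390625 * ensemble p x y (fun a b => a 1 * a 1 * (b 1 * b 1)) +
      28224 / 390625 * (ensemble p x y (fun a b => a 0 * a 0 * (b 1 * b 1)) +
        ensemble p x y (fun a b => a 1 * a 1 * (b 0 * b 0)) +
        4 * ensemble p x y (fun a b => a 0 * a 1 * (b 0 * b 1))) -
      16464 / 390625 * (ensemble p x y (fun a b => a 0 * a 0 * (b 0 * b 1)) +
        ensemble p x y (fun a b => a 0 * a 1 * (b 0 * b 0))) -
      193536 / 390625 * (ensemble p x y (fun a b => a 1 * a 1 * (b 0 * b 1)) +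
        ensemble p x y (fun a b => a 0 * a 1 * (b 1 * b 1))) := by
    simp only [ensemble, Finset.mul_sum, ← Finset.sum_sub_distrib, ← Finset.sum_add_distrib]
    exact Finset.sum_congr rfl fun k _ => by ring
  simp only [cons_val] at g
  linarith

/-- Expansion of the mean of `f a * f b` for quadratic `f` into the moments that the half-turns
about the axes do not annihilate. -/
theorem IsRotationInvariant.ensemble_quadratic (hR : IsRotationInvariant p x y)
    (c h₀ h₁ h₂ r₀ r₁ r₂ q₀ q₁ q₂ : ℝ) {f : (Fin 3 → ℝ) → ℝ} (hf : IsObservable f)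
    (hfe : ∀ a, f a = 1 / 2 * (c + 2 * (h₀ * a 0 + h₁ * a 1 + h₂ * a 2) +
      (r₀ * a 0 ^ 2 + r₁ * a 1 ^ 2 + r₂ * a 2 ^ 2) +
      2 * (q₀ * (a 1 * a 2) + q₁ * (a 2 * a 0) + q₂ * (a 0 * a 1)))) :
    ensemble p x y (fun a b => f a * f b) = 1 / 4 * (
      c ^ 2 * ensemble p x y (fun _ _ => 1) +
      c * r₀ * (ensemble p x y (fun a _ => a 0 * a 0 * 1) +
        ensemble p x y (fun _ b => 1 * (b 0 * b 0))) +
      c * r₁ * (ensemble p x y (fun a _ => a 1 * a 1 * 1) +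
        ensemble p x y (fun _ b => 1 * (b 1 * b 1))) +
      c * r₂ * (ensemble p x y (fun a _ => a 2 * a 2 * 1) +
        ensemble p x y (fun _ b => 1 * (b 2 * b 2))) +
      r₀ ^ 2 * ensemble p x y (fun a b => a 0 * a 0 * (b 0 * b 0)) +
      r₁ ^ 2 * ensemble p x y (fun a b => a 1 * a 1 * (b 1 * b 1)) +
      r₂ ^ 2 * ensemble p x y (fun a b => a 2 * a 2 * (b 2 * b 2)) +
      r₀ * r₁ * (ensemble p x y (fun a b => a 0 * a 0 * (b 1 * b 1)) +
        ensemble p x y (fun a b => a 1 * a 1 * (b 0 * b 0))) +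
      r₁ * r₂ * (ensemble p x y (fun a b => a 1 * a 1 * (b 2 * b 2)) +
        ensemble p x y (fun a b => a 2 * a 2 * (b 1 * b 1))) +
      r₂ * r₀ * (ensemble p x y (fun a b => a 2 * a 2 * (b 0 * b 0)) +
        ensemble p x y (fun a b => a 0 * a 0 * (b 2 * b 2))) +
      4 * (h₀ ^ 2 * ensemble p x y (fun a b => a 0 * b 0) +
        h₁ ^ 2 * ensemble p x y (fun a b => a 1 * b 1) +
        h₂ ^ 2 * ensemble p x y (fun a b => a 2 * b 2) +
        h₀ * q₀ * (ensemble p x y (fun a b => a 0 * (b 1 * b 2)) +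
          ensemble p x y (fun a b => a 1 * a 2 * b 0)) +
        h₁ * q₁ * (ensemble p x y (fun a b => a 1 * (b 2 * b 0)) +
          ensemble p x y (fun a b => a 2 * a 0 * b 1)) +
        h₂ * q₂ * (ensemble p x y (fun a b => a 2 * (b 0 * b 1)) +
          ensemble p x y (fun a b => a 0 * a 1 * b 2)) +
        q₀ ^ 2 * ensemble p x y (fun a b => a 1 * a 2 * (b 1 * b 2)) +
        q₁ ^ 2 * ensemble p x y (fun a b => a 2 * a 0 * (b 2 * b 0)) +
        q₂ ^ 2 * ensemble p x y (fun a b => a 0 * a 1 * (b 0 * b 1)))) := by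
  -- averaging over the half-turns removes the terms that are odd under one of them
  have hK : ensemble p x y (fun a b => f a * f b) = 1 / 4 * ensemble p x y (fun a b =>
      (c + (r₀ * a 0 ^ 2 + r₁ * a 1 ^ 2 + r₂ * a 2 ^ 2)) *
        (c + (r₀ * b 0 ^ 2 + r₁ * b 1 ^ 2 + r₂ * b 2 ^ 2)) +
      4 * ((h₀ * a 0 + q₀ * (a 1 * a 2)) * (h₀ * b 0 + q₀ * (b 1 * b 2)) +
        (h₁ * a 1 + q₁ * (a 2 * a 0)) * (h₁ * b 1 + q₁ * (b 2 * b 0)) +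
        (h₂ * a 2 + q₂ * (a 0 * a 1)) * (h₂ * b 2 + q₂ * (b 0 * b 1)))) := by
    have h4 : ensemble p x y (fun a b => f a * f b) =
        1 / 4 * (ensemble p x y (fun a b => f a * f b) +
        ensemble p x y (fun a b => f ![a 0, -a 1, -a 2] * f ![b 0, -b 1, -b 2]) +
        ensemble p x y (fun a b => f ![-a 0, a 1, -a 2] * f ![-b 0, b 1, -b 2]) +
        ensemble p x y (fun a b => f ![-a 0, -a 1, a 2] * f ![-b 0, -b 1, b 2])) := by
      rw [hR.halfTurn_zero f f hf hf, hR.halfTurn_one f f hf hf, hR.halfTurn_two f f hf hf]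
      ring
    rw [h4]
    congr 1
    simp only [ensemble, hfe, ← Finset.sum_add_distrib]
    refine Finset.sum_congr rfl fun k _ => ?_
    simp only [cons_val]
    ring
  rw [hK]
  congr 1
  simp only [ensemble, Finset.mul_sum, ← Finset.sum_add_distrib]
  exact Finset.sum_congr rfl fun k _ => by ring

/-- The bound for fourth moments `A`, `B`, `B'`, `D` that are related by invariance; `A + 2 * D`
is a multiple of the mean of `(a ⬝ b) ^ 2`. -/
theorem moment_bound {A B B' D : ℝ} (h : 2 * A = B + B' + 4 * D) (h' : A + B + B' = 4 / 3)
    (hA : 0 ≤ A + 2 * D) (c r₀ r₁ r₂ q₀ q₁ q₂ : ℝ) :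
    c ^ 2 + 2 / 3 * c * (r₀ + r₁ + r₂) + 2 / 15 * (r₀ + r₁ + r₂) ^ 2 -
      1 / 15 * (r₀ ^ 2 + r₁ ^ 2 + r₂ ^ 2 + 2 * (q₂ ^ 2 + q₀ ^ 2 + q₁ ^ 2)) ≤
      1 / 4 * (c ^ 2 * 4 + c * (r₀ + r₁ + r₂) * (8 / 3) + (r₀ ^ 2 + r₁ ^ 2 + r₂ ^ 2) * A +
        (r₀ * r₁ + r₁ * r₂ + r₂ * r₀) * (B + B') + 4 * (q₀ ^ 2 + q₁ ^ 2 + q₂ ^ 2) * D) := by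
  have eA : A = 4 / 9 + 4 / 3 * D := by linarith
  have eB : B + B' = 8 / 9 - 4 / 3 * D := by linarith
  have hD : 0 ≤ D + 2 / 15 := by linarith
  rw [eB, eA]
  have hq : 0 ≤ (r₀ - r₁) ^ 2 + (r₁ - r₂) ^ 2 + (r₂ - r₀) ^ 2 +
      6 * (q₀ ^ 2 + q₁ ^ 2 + q₂ ^ 2) := by positivity
  linear_combination (1 / 6 : ℝ) * mul_nonneg hD hq

/-- Lower bound for the mean of `f a * f b`, where `f` is quadratic, in an invariant ensemble of
total weight `4` in which `a ⬝ b` has mean zero. Invariance leaves one free parameter in the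
relevant moments, which is bounded as the mean of `(a ⬝ b) ^ 2` is nonnegative. -/
theorem IsRotationInvariant.quadratic_le_ensemble (hR : IsRotationInvariant p x y)
    (hp : ∀ k, 0 ≤ p k) (hx : ∀ k, IsUnitVec (x k)) (hy : ∀ k, IsUnitVec (y k))
    (h1 : ensemble p x y (fun _ _ => 1) = 4)
    (hdot : ensemble p x y (fun a b => a 0 * b 0 + a 1 * b 1 + a 2 * b 2) = 0)
    (c h₀ h₁ h₂ r₀ r₁ r₂ q₀ q₁ q₂ : ℝ) {f : (Fin 3 → ℝ) → ℝ} (hf : IsObservable f)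
    (hfe : ∀ a, f a = 1 / 2 * (c + 2 * (h₀ * a 0 + h₁ * a 1 + h₂ * a 2) +
      (r₀ * a 0 ^ 2 + r₁ * a 1 ^ 2 + r₂ * a 2 ^ 2) +
      2 * (q₀ * (a 1 * a 2) + q₁ * (a 2 * a 0) + q₂ * (a 0 * a 1)))) :
    c ^ 2 + 2 / 3 * c * (r₀ + r₁ + r₂) + 2 / 15 * (r₀ + r₁ + r₂) ^ 2 -
      1 / 15 * (r₀ ^ 2 + r₁ ^ 2 + r₂ ^ 2 + 2 * (q₂ ^ 2 + q₀ ^ 2 + q₁ ^ 2)) ≤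
      ensemble p x y fun a b => f a * f b := by
  have o1 := isObservable_one
  have o := isObservable_coord
  have oo := isObservable_coord_mul
  have hC := hR.cyclic
  -- the cyclic permutation of the axes identifies moments
  have a0 := hC.eq_of_comp (oo 0 0) o1 (F := fun a _ => a 2 * a 2 * 1) (by intros; simp)
  have a1 := hC.eq_of_comp (oo 1 1) o1 (F := fun a _ => a 0 * a 0 * 1) (by intros; simp)
  have b0 := hC.eq_of_comp o1 (oo 0 0) (F := fun _ b => 1 * (b 2 * b 2)) (by intros; simp)
  have b1 := hC.eq_of_comp o1 (oo 1 1) (F := fun _ b => 1 * (b 0 * b 0)) (by intros; simp)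
  have d0 := hC.eq_of_comp (o 0) (o 0) (F := fun a b => a 2 * b 2) (by intros; simp)
  have d1 := hC.eq_of_comp (o 1) (o 1) (F := fun a b => a 0 * b 0) (by intros; simp)
  have s0 := hC.eq_of_comp (oo 0 0) (oo 0 0) (F := fun a b => a 2 * a 2 * (b 2 * b 2))
    (by intros; simp)
  have s1 := hC.eq_of_comp (oo 1 1) (oo 1 1) (F := fun a b => a 0 * a 0 * (b 0 * b 0))
    (by intros; simp)
  have u0 := hC.eq_of_comp (oo 0 0) (oo 1 1) (F := fun a b => a 2 * a 2 * (b 0 * b 0))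
    (by intros; simp)
  have u1 := hC.eq_of_comp (oo 1 1) (oo 2 2) (F := fun a b => a 0 * a 0 * (b 1 * b 1))
    (by intros; simp)
  have w0 := hC.eq_of_comp (oo 1 1) (oo 0 0) (F := fun a b => a 0 * a 0 * (b 2 * b 2))
    (by intros; simp)
  have w1 := hC.eq_of_comp (oo 2 2) (oo 1 1) (F := fun a b => a 1 * a 1 * (b 0 * b 0))
    (by intros; simp)
  have e0 := hC.eq_of_comp (oo 1 2) (oo 1 2) (F := fun a b => a 0 * a 1 * (b 0 * b 1))
    (by intros; simp)
  have e1 := hC.eq_of_comp (oo 2 0) (oo 2 0) (F := fun a b => a 1 * a 2 * (b 1 * b 2))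
    (by intros; simp)
  obtain ⟨m0, m1, m2⟩ := hR.moment_one_two
  obtain ⟨n0, n1, n2⟩ := hR.moment_two_one
  have g := hR.moment_two_two
  -- the Bloch vectors are unit vectors
  have hT : ensemble p x y (fun a _ => a 0 * a 0 * 1) + ensemble p x y (fun a _ => a 1 * a 1 * 1) +
      ensemble p x y (fun a _ => a 2 * a 2 * 1) = 4 := by
    rw [← h1]
    simp only [ensemble, ← Finset.sum_add_distrib]
    refine Finset.sum_congr rfl fun k _ => ?_
    have := hx k
    unfold IsUnitVec at this
    linear_combination p k * this
  have hT' : ensemble p x y (fun _ b => 1 * (b 0 * b 0)) +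
      ensemble p x y (fun _ b => 1 * (b 1 * b 1)) +
      ensemble p x y (fun _ b => 1 * (b 2 * b 2)) = 4 := by
    rw [← h1]
    simp only [ensemble, ← Finset.sum_add_distrib]
    refine Finset.sum_congr rfl fun k _ => ?_
    have := hy k
    unfold IsUnitVec at this
    linear_combination p k * this
  have hS : ensemble p x y (fun a b => a 0 * a 0 * (b 0 * b 0)) +
      ensemble p x y (fun a b => a 0 * a 0 * (b 1 * b 1)) +
      ensemble p x y (fun a b => a 0 * a 0 * (b 2 * b 2)) =
      ensemble p x y (fun a _ => a 0 * a 0 * 1) := by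
    simp only [ensemble, ← Finset.sum_add_distrib]
    refine Finset.sum_congr rfl fun k _ => ?_
    have := hy k
    unfold IsUnitVec at this
    linear_combination p k * x k 0 ^ 2 * this
  have hD : ensemble p x y (fun a b => a 0 * b 0) + ensemble p x y (fun a b => a 1 * b 1) +
      ensemble p x y (fun a b => a 2 * b 2) = 0 := by
    rw [← hdot]
    simp only [ensemble, ← Finset.sum_add_distrib, mul_add]
  have hsq : 0 ≤ ensemble p x y (fun a b => a 0 * a 0 * (b 0 * b 0)) +
      ensemble p x y (fun a b => a 1 * a 1 * (b 1 * b 1)) +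
      ensemble p x y (fun a b => a 2 * a 2 * (b 2 * b 2)) +
      2 * (ensemble p x y (fun a b => a 0 * a 1 * (b 0 * b 1)) +
      ensemble p x y (fun a b => a 1 * a 2 * (b 1 * b 2)) +
      ensemble p x y (fun a b => a 2 * a 0 * (b 2 * b 0))) := by
    have h : 0 ≤ ensemble p x y fun a b => (a 0 * b 0 + a 1 * b 1 + a 2 * b 2) ^ 2 :=
      Finset.sum_nonneg fun k _ => mul_nonneg (hp k) (sq_nonneg _)
    refine h.trans_eq ?_
    simp only [ensemble, Finset.mul_sum, ← Finset.sum_add_distrib]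
    exact Finset.sum_congr rfl fun k _ => by ring
  rw [hR.ensemble_quadratic c h₀ h₁ h₂ r₀ r₁ r₂ q₀ q₁ q₂ hf hfe, h1, m0, m1, m2, n0, n1, n2, u0,
    ← u1, ← w1, w0, ← e1, ← e0, s0, ← s1, a0, ← a1, b0,
    ← b1, d0, ← d1]
  rw [d0, ← d1] at hD
  rw [s0, ← s1, ← e1, ← e0] at hsq
  rw [a0, ← a1] at hT
  rw [b0, ← b1] at hT'
  rw [w0] at hS
  have eT : ensemble p x y (fun a _ => a 0 * a 0 * 1) = 4 / 3 := by linarith only [hT]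
  have eT' : ensemble p x y (fun _ b => 1 * (b 0 * b 0)) = 4 / 3 := by linarith only [hT']
  have eD : ensemble p x y (fun a b => a 0 * b 0) = 0 := by linarith only [hD]
  rw [eT] at hS
  rw [eT, eT', eD]
  exact (moment_bound g hS (by linarith only [hsq]) c r₀ r₁ r₂ q₀ q₁ q₂).trans_eq (by ring)

end Moments

/-! ### Optimality -/

/-- No test of level zero that is V-invariant and termwise AB-covariant has a smaller type 2
error than `testV`. -/
theorem typeTwoError_testV_le {T : Matrix Pair Pair ℂ} (hT : IsTest T)
    (hL : IsLevel nullStates 0 T) (hV : IsVInvariant T) (hc : IsTermwiseABCovariant T)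
    {σ : Matrix Sample Sample ℂ} (hσ : σ.IsHermitian) :
    typeTwoError testV (σ ⊗ₖ σ) ≤ typeTwoError T (σ ⊗ₖ σ) := by
  obtain ⟨m, p, x, y, hp, hx, hy, rfl⟩ := hc.exists_twin
  have hfix := mulVec_eVec_zero_zero hT hL
  -- the matrix elements `⟨eⁱⁱ| T |e⁰⁰⟩`
  have hel : ∀ i, ∑ k, (p k : ℂ) * (1 / 2 * (twinCoeff (x k) i * star (twinCoeff (x k) 0)) *
      (1 / 2 * (twinCoeff (y k) i * star (twinCoeff (y k) 0)))) = if 0 = i then 1 else 0 := by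
    intro i
    have h : (∑ k, (p k : ℂ) • (twin (x k) ⊗ₖ twin (y k))) * (phiUnit 0 i ⊗ₖ phiUnit 0 i) =
        phiUnit 0 i ⊗ₖ phiUnit 0 i := by
      rw [← vecMulVec_eVec, mul_vecMulVec, hfix]
    have h2 := congrArg trace h
    simp only [Finset.sum_mul, smul_mul_assoc, ← mul_kronecker_mul, trace_sum, trace_smul,
      trace_kronecker, trace_twin_mul_phiUnit (hx _), trace_twin_mul_phiUnit (hy _),
      trace_phiUnit, smul_eq_mul] at h2
    rw [h2]
    split <;> simp
  have h1 : ensemble p x y (fun _ _ => 1) = 4 := by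
    have h := congrArg Complex.re (hel 0)
    simp [twinCoeff, ← Finset.sum_mul] at h
    simp only [ensemble, mul_one]
    linarith
  have hi : ∀ i : Fin 3, ∑ k, p k * (x k i * y k i) = 0 := by
    intro i
    have h := hel i.succ
    have h3 : ∑ k, (p k : ℂ) * (1 / 2 * (twinCoeff (x k) i.succ * star (twinCoeff (x k) 0)) *
      (1 / 2 * (twinCoeff (y k) i.succ * star (twinCoeff (y k) 0)))) =
      ((-1 / 4 * ∑ k, p k * (x k i * y k i) : ℝ) : ℂ) := by
      push_cast
      rw [Finset.mul_sum]
      refine Finset.sum_congr rfl fun k _ => ?_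
      fin_cases i <;> simp [twinCoeff] <;> ring_nf <;> simp only [Complex.I_sq] <;> ring
    rw [h3, if_neg (Fin.succ_ne_zero i).symm] at h
    have h4 : -1 / 4 * ∑ k, p k * (x k i * y k i) = 0 := by exact_mod_cast h
    linarith
  have hdot : ensemble p x y (fun a b => a 0 * b 0 + a 1 * b 1 + a 2 * b 2) = 0 := by
    simp only [ensemble, mul_add, Finset.sum_add_distrib, hi, add_zero]
  have hR : IsRotationInvariant p x y := fun _ _ _ _ h => hV.preserves_rotate hx hy h
  have hb := hR.quadratic_le_ensemble hp hx hy h1 hdot _ _ _ _ _ _ _ _ _ _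
    ⟨σ, fun z hz => trace_mul_twin hσ hz⟩ fun a => rfl
  rw [typeTwoError_testV_eq hσ]
  refine hb.trans_eq ?_
  rw [typeTwoError, Finset.mul_sum, trace_sum, Complex.re_sum]
  refine Finset.sum_congr rfl fun k _ => ?_
  rw [mul_smul_comm, ← mul_kronecker_mul, trace_smul, trace_kronecker, trace_mul_twin hσ (hx k),
    trace_mul_twin hσ (hy k), smul_eq_mul, ← Complex.ofReal_mul, ← Complex.ofReal_mul,
    Complex.ofReal_re]

end EntTest

end

theorem theorem3 :
    -- `testV` is UMP of level zero under the separate localities and the other conditions,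
    IsUMP (fun T => IsABLocal T ∧ IsSamplewiseLocal T ∧ IsVInvariant T ∧ IsABInvariant T ∧
        IsTermwiseABCovariant T) nullStates altStates 0 testV ∧
    -- and also when both localities are required of one and the same protocol;
    IsUMP (fun T => IsJointlyLocal T ∧ IsVInvariant T ∧ IsABInvariant T ∧
        IsTermwiseABCovariant T) nullStates altStates 0 testV ∧
    -- it is symmetric in the two samples, as is required of all tests without loss of generality;
    IsSampleSymmetric testV ∧
    -- and its type 2 error has an explicit form.
    ∀ σ : Matrix Sample Sample ℂ, IsDensity σ → σ ≠ ketbra (phi 0) →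
      typeTwoError testV (σ ⊗ₖ σ) =
        vVec σ ⬝ᵥ (zMat *ᵥ vVec σ) -
          2 / 15 * ((xEl σ 1 2).re ^ 2 + (xEl σ 2 3).re ^ 2 + (xEl σ 3 1).re ^ 2) := by
  have htest : IsTest testV := IsLOCC.isTest isJointlyLocal_testV
  refine ⟨⟨⟨htest, ⟨isJointlyLocal_testV.isABLocal, isJointlyLocal_testV.isSamplewiseLocal,
    isVInvariant_testV, isABInvariant_testV, isTermwiseABCovariant_testV⟩, isLevel_testV⟩, ?_⟩,
    ⟨⟨htest, ⟨isJointlyLocal_testV, isVInvariant_testV, isABInvariant_testV,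
    isTermwiseABCovariant_testV⟩, isLevel_testV⟩, ?_⟩, isSampleSymmetric_testV,
    fun σ hσ _ => typeTwoError_testV hσ⟩
  · rintro _ ⟨σ, hσ, -, rfl⟩ T hT ⟨-, -, hV, -, hc⟩ hL
    exact typeTwoError_testV_le hT hL hV hc hσ.1.isHermitian
  · rintro _ ⟨σ, hσ, -, rfl⟩ T hT ⟨-, hV, -, hc⟩ hL
    exact typeTwoError_testV_le hT hL hV hc hσ.1.isHermitian
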